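/- Let $\nabla$ be a torsion-free affine connection on a smooth $n$-manifold, $n\ge 2$, with curvature $(\nabla_a\nabla_b-\nabla_b\nabla_a)v^c=R_{ab}{}^c{}_d v^d$ and Ricci tensor $\mathrm{Ric}_{ab}=R_{ca}{}^c{}_b$. Its projective Weyl tensor $W$ is defined by $R_{ab}{}^c{}_d=W_{ab}{}^c{}_d+\delta^c_aP_{bd}-\delta^c_bP_{ad}+\beta_{ab}\delta^c_d$ with $(n-1)P_{ab}=\mathrm{Ric}_{ab}+\beta_{ab}$ and $\beta_{ab}=P_{ba}-P_{ab}$. The connection is *weakly generic at $x$* if the linear map $T^*_xM\to\Lambda^2T^*_xM\otimes T^*_xM$, $\theta_c\mapsto W_{ab}{}^c{}_d\,\theta_c$, has trivial kernel, and *weakly generic* if this holds at every point. **Proposition.** (A) Let $g$ be a smooth Ricci-flat pseudo-Riemannian metric on a smooth $4$-manifold $M$, with Levi-Civita connection $\nabla$ and conformal Weyl tensor $\widetilde W$. 1. $W_{ab}{}^c{}_d=\widetilde W_{ab}{}^c{}_d$, and $4\,\widetilde W_{ij}{}^k{}_l\,\widetilde W^{ij}{}_k{}^m=|\widetilde W|^2\,\delta^m_l$,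 where $|\widetilde W|^2=\widetilde W_{ijkl}\widetilde W^{ijkl}$. 2. $\nabla$ is weakly generic at every point $x$ with $|\widetilde W|^2(x)\neq0$. 3. If $g$ is positive definite, then $\nabla$ is weakly generic at $x$ if and only if $\widetilde W(x)\ne 0$. In particular, if $\widetilde W$ vanishes at no point of $M$, then $\nabla$ is weakly generic. Moreover, if $g$ is positive definite and $U\subseteq M$ is an open set on which $g$ is not locally conformally flat, then there is a non-empty open set $V\subseteq U$ such that $\nabla$ is weakly generic at every point of $V$. (Here $g$ is locally conformally flat on $U$ if every point of $U$ has an open neighbourhood on which some multiple $\varphi g$, with $\varphi$ smooth and positive, has zero curvature.) (B) There exist torsion-free weakly generic connections: on $\mathbb R^4$ there is a Ricci-flat Riemannian metric whose conformal Weyl tensor vanishes at no point, and its Levi-Civita connection is torsion-free and weakly generic. -/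

import Mathlib

open Bundle Set
open scoped Manifold ContDiff Topology

universe u

noncomputable section

/-- The `i`-th vector of the basis of `T_x M` given by the preferred chart at `x`
(for the model `ℝⁿ`, Mathlib's tangent space at `x` is `ℝⁿ`, read in that chart). -/
def tangentFrame {n : ℕ} {M : Type u} [TopologicalSpace M]
    [ChartedSpace (EuclideanSpace ℝ (Fin n)) M] (x : M) (i : Fin n) : TangentSpace (𝓡 n) x :=
  (EuclideanSpace.single i (1 : ℝ) : EuclideanSpace ℝ (Fin n))

/-- The `i`-th coordinate of a tangent vector in the basis `tangentFrame x`. -/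
def tangentCoord {n : ℕ} {M : Type u} [TopologicalSpace M]
    [ChartedSpace (EuclideanSpace ℝ (Fin n)) M] (x : M) (v : TangentSpace (𝓡 n) x) (i : Fin n) :
    ℝ :=
  (show EuclideanSpace ℝ (Fin n) from v) i

/-- A smooth pseudo-Riemannian metric (of arbitrary signature) on a smooth `n`-manifold `M`. -/
structure PseudoRiemannianMetric (n : ℕ) (M : Type u) [TopologicalSpace M]
    [ChartedSpace (EuclideanSpace ℝ (Fin n)) M] [IsManifold (𝓡 n) ∞ M] where
  /-- The bilinear form on each tangent space. -/
  form (x : M) : TangentSpace (𝓡 n) x →L[ℝ] TangentSpace (𝓡 n) x →L[ℝ] ℝ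
  symm (x : M) (v w : TangentSpace (𝓡 n) x) : form x v w = form x w v
  nondegenerate (x : M) (v : TangentSpace (𝓡 n) x) (hv : ∀ w, form x v w = 0) : v = 0
  contMDiff : ContMDiff (𝓡 n)
    ((𝓡 n).prod 𝓘(ℝ, EuclideanSpace ℝ (Fin n) →L[ℝ] EuclideanSpace ℝ (Fin n) →L[ℝ] ℝ)) ∞
    (fun x ↦ TotalSpace.mk' (EuclideanSpace ℝ (Fin n) →L[ℝ] EuclideanSpace ℝ (Fin n) →L[ℝ] ℝ)
      x (form x))

/-- The metric is positive definite. -/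
def PseudoRiemannianMetric.IsRiemannian {n : ℕ} {M : Type u} [TopologicalSpace M]
    [ChartedSpace (EuclideanSpace ℝ (Fin n)) M] [IsManifold (𝓡 n) ∞ M]
    (g : PseudoRiemannianMetric n M) : Prop :=
  ∀ (x : M) (v : TangentSpace (𝓡 n) x), v ≠ 0 → 0 < g.form x v v

section

variable {n : ℕ} {M : Type u} [TopologicalSpace M]
  [ChartedSpace (EuclideanSpace ℝ (Fin n)) M] [IsManifold (𝓡 n) ∞ M]

/-- The vector field `X` is differentiable at `x`. -/
def IsDifferentiableFieldAt (X : (x : M) → TangentSpace (𝓡 n) x) (x : M) : Prop :=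
  MDifferentiableAt (𝓡 n) ((𝓡 n).prod 𝓘(ℝ, EuclideanSpace ℝ (Fin n)))
    (fun y ↦ (⟨y, X y⟩ : TotalSpace (EuclideanSpace ℝ (Fin n)) (TangentSpace (𝓡 n) : M → Type))) x

/-- On the open set `U`, the operator `cov` is a smooth affine connection, it is torsion-free,
`∇_X Y - ∇_Y X = [X, Y]`, and it preserves the metric `B`,
`X (B(Y, Z)) = B(∇_X Y, Z) + B(Y, ∇_X Z)`: it is the Levi-Civita connection of `B` on `U`.
As in Mathlib, `∇_X Y` at `x` is written `cov Y x (X x)`. -/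
structure IsLeviCivitaOn
    (B : (x : M) → TangentSpace (𝓡 n) x →L[ℝ] TangentSpace (𝓡 n) x →L[ℝ] ℝ)
    (cov : ((x : M) → TangentSpace (𝓡 n) x) →
      ((x : M) → TangentSpace (𝓡 n) x →L[ℝ] TangentSpace (𝓡 n) x))
    (U : Set M) : Prop where
  isCovariantDerivativeOn : IsCovariantDerivativeOn (EuclideanSpace ℝ (Fin n)) cov U
  smooth : ContMDiffCovariantDerivativeOn (EuclideanSpace ℝ (Fin n)) ∞ cov U
  torsion_free : ∀ x ∈ U, ∀ X Y : (x : M) → TangentSpace (𝓡 n) x,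
    IsDifferentiableFieldAt X x → IsDifferentiableFieldAt Y x →
      cov Y x (X x) - cov X x (Y x) = VectorField.mlieBracket (𝓡 n) X Y x
  metric : ∀ x ∈ U, ∀ Y Z : (x : M) → TangentSpace (𝓡 n) x,
    IsDifferentiableFieldAt Y x → IsDifferentiableFieldAt Z x → ∀ v : TangentSpace (𝓡 n) x,
      mvfderiv (𝓡 n) (fun y ↦ B y (Y y) (Z y)) x v =
        B x (cov Y x v) (Z x) + B x (Y x) (cov Z x v)

/-- The curvature `∇_X ∇_Y Z - ∇_Y ∇_X Z - ∇_[X, Y] Z` as an operation on vector fields. -/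
def curvatureField
    (cov : ((x : M) → TangentSpace (𝓡 n) x) →
      ((x : M) → TangentSpace (𝓡 n) x →L[ℝ] TangentSpace (𝓡 n) x))
    (X Y Z : (x : M) → TangentSpace (𝓡 n) x) (x : M) : TangentSpace (𝓡 n) x :=
  cov (fun y ↦ cov Z y (Y y)) x (X x) - cov (fun y ↦ cov Z y (X y)) x (Y x)
    - cov Z x (VectorField.mlieBracket (𝓡 n) X Y x)

/-- The curvature tensor `R(u, v) w`, with components `(R(u, v) w)ᶜ = uᵃ vᵇ R_{ab}ᶜ_d wᵈ`.
The tangent vectors are extended to vector fields that are smooth near `x`; for a smooth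
connection the result does not depend on the extension. -/
def curvature
    (cov : ((x : M) → TangentSpace (𝓡 n) x) →
      ((x : M) → TangentSpace (𝓡 n) x →L[ℝ] TangentSpace (𝓡 n) x))
    (x : M) (u v w : TangentSpace (𝓡 n) x) : TangentSpace (𝓡 n) x :=
  curvatureField cov (FiberBundle.extend (EuclideanSpace ℝ (Fin n)) u)
    (FiberBundle.extend (EuclideanSpace ℝ (Fin n)) v)
    (FiberBundle.extend (EuclideanSpace ℝ (Fin n)) w) x

/-- The Ricci tensor `Ric_{ab} = R_{ca}ᶜ_b`, the trace of `u ↦ R(u, v) w`. -/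
def ricci
    (cov : ((x : M) → TangentSpace (𝓡 n) x) →
      ((x : M) → TangentSpace (𝓡 n) x →L[ℝ] TangentSpace (𝓡 n) x))
    (x : M) (v w : TangentSpace (𝓡 n) x) : ℝ :=
  ∑ c : Fin n, tangentCoord x (curvature cov x (tangentFrame x c) v w) c

/-- The Ricci tensor vanishes identically. -/
def IsRicciFlat
    (cov : ((x : M) → TangentSpace (𝓡 n) x) →
      ((x : M) → TangentSpace (𝓡 n) x →L[ℝ] TangentSpace (𝓡 n) x)) : Prop :=
  ∀ (x : M) (v w : TangentSpace (𝓡 n) x), ricci cov x v w = 0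

/-- The skew tensor `β_{ab} = - (Ric_{ab} - Ric_{ba}) / (n + 1)` in the decomposition
`R_{ab}ᶜ_d = W_{ab}ᶜ_d + δᶜ_a P_{bd} - δᶜ_b P_{ad} + β_{ab} δᶜ_d`. -/
def projectiveBeta
    (cov : ((x : M) → TangentSpace (𝓡 n) x) →
      ((x : M) → TangentSpace (𝓡 n) x →L[ℝ] TangentSpace (𝓡 n) x))
    (x : M) (u v : TangentSpace (𝓡 n) x) : ℝ :=
  -(ricci cov x u v - ricci cov x v u) / ((n : ℝ) + 1)

/-- The projective Schouten tensor: `(n - 1) P_{ab} = Ric_{ab} + β_{ab}`. -/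
def projectiveSchouten
    (cov : ((x : M) → TangentSpace (𝓡 n) x) →
      ((x : M) → TangentSpace (𝓡 n) x →L[ℝ] TangentSpace (𝓡 n) x))
    (x : M) (u v : TangentSpace (𝓡 n) x) : ℝ :=
  (ricci cov x u v + projectiveBeta cov x u v) / ((n : ℝ) - 1)

/-- The projective Weyl tensor `W(u, v) w`, with components `uᵃ vᵇ W_{ab}ᶜ_d wᵈ`. -/
def projectiveWeyl
    (cov : ((x : M) → TangentSpace (𝓡 n) x) →
      ((x : M) → TangentSpace (𝓡 n) x →L[ℝ] TangentSpace (𝓡 n) x))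
    (x : M) (u v w : TangentSpace (𝓡 n) x) : TangentSpace (𝓡 n) x :=
  curvature cov x u v w
    - (projectiveSchouten cov x v w • u - projectiveSchouten cov x u w • v)
    - projectiveBeta cov x u v • w

/-- The map `T*_x M → Λ² T*_x M ⊗ T*_x M`, `θ_c ↦ W_{ab}ᶜ_d θ_c`, has trivial kernel. -/
def IsWeaklyGenericAt
    (cov : ((x : M) → TangentSpace (𝓡 n) x) →
      ((x : M) → TangentSpace (𝓡 n) x →L[ℝ] TangentSpace (𝓡 n) x)) (x : M) : Prop :=
  ∀ θ : TangentSpace (𝓡 n) x →L[ℝ] ℝ,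
    (∀ u v w : TangentSpace (𝓡 n) x, θ (projectiveWeyl cov x u v w) = 0) → θ = 0

/-- The connection is weakly generic: the Weyl map on covectors has trivial kernel at every
point. -/
def IsWeaklyGeneric
    (cov : ((x : M) → TangentSpace (𝓡 n) x) →
      ((x : M) → TangentSpace (𝓡 n) x →L[ℝ] TangentSpace (𝓡 n) x)) : Prop :=
  ∀ x : M, IsWeaklyGenericAt cov x

/-- The inverse metric `g^{ab}` in the basis `tangentFrame x`. -/
def inverseMetric
    (B : (x : M) → TangentSpace (𝓡 n) x →L[ℝ] TangentSpace (𝓡 n) x →L[ℝ] ℝ) (x : M) :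
    Matrix (Fin n) (Fin n) ℝ :=
  (Matrix.of fun a b ↦ B x (tangentFrame x a) (tangentFrame x b))⁻¹

/-- The scalar curvature `g^{ab} Ric_{ab}`. -/
def scalarCurvature
    (B : (x : M) → TangentSpace (𝓡 n) x →L[ℝ] TangentSpace (𝓡 n) x →L[ℝ] ℝ)
    (cov : ((x : M) → TangentSpace (𝓡 n) x) →
      ((x : M) → TangentSpace (𝓡 n) x →L[ℝ] TangentSpace (𝓡 n) x)) (x : M) : ℝ :=
  ∑ a : Fin n, ∑ b : Fin n,
    inverseMetric B x a b * ricci cov x (tangentFrame x a) (tangentFrame x b)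

/-- The conformal Schouten tensor: `Ric_{ab} = (n - 2) P_{ab} + J g_{ab}` with `J = g^{ab} P_{ab}`,
that is, with `J` equal to the scalar curvature over `2 (n - 1)`. -/
def conformalSchouten
    (B : (x : M) → TangentSpace (𝓡 n) x →L[ℝ] TangentSpace (𝓡 n) x →L[ℝ] ℝ)
    (cov : ((x : M) → TangentSpace (𝓡 n) x) →
      ((x : M) → TangentSpace (𝓡 n) x →L[ℝ] TangentSpace (𝓡 n) x))
    (x : M) (u v : TangentSpace (𝓡 n) x) : ℝ :=
  (ricci cov x u v - scalarCurvature B cov x / (2 * ((n : ℝ) - 1)) * B x u v) / ((n : ℝ) - 2)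

/-- The conformal Weyl tensor with all indices lowered,
`W_{abcd} = R_{abcd} - (g_{ca} P_{bd} - g_{cb} P_{ad}) - (g_{db} P_{ac} - g_{da} P_{bc})`, where
`R_{abcd} = g_{ce} R_{ab}ᵉ_d`, evaluated at `uᵃ vᵇ zᶜ wᵈ`. Here `cov` is the Levi-Civita
connection of `B`. -/
def conformalWeyl
    (B : (x : M) → TangentSpace (𝓡 n) x →L[ℝ] TangentSpace (𝓡 n) x →L[ℝ] ℝ)
    (cov : ((x : M) → TangentSpace (𝓡 n) x) →
      ((x : M) → TangentSpace (𝓡 n) x →L[ℝ] TangentSpace (𝓡 n) x))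
    (x : M) (u v z w : TangentSpace (𝓡 n) x) : ℝ :=
  B x z (curvature cov x u v w)
    - (B x z u * conformalSchouten B cov x v w - B x z v * conformalSchouten B cov x u w)
    - (B x w v * conformalSchouten B cov x u z - B x w u * conformalSchouten B cov x v z)

/-- The components `W_{abcd}` of the conformal Weyl tensor. -/
def conformalWeylComp
    (B : (x : M) → TangentSpace (𝓡 n) x →L[ℝ] TangentSpace (𝓡 n) x →L[ℝ] ℝ)
    (cov : ((x : M) → TangentSpace (𝓡 n) x) →
      ((x : M) → TangentSpace (𝓡 n) x →L[ℝ] TangentSpace (𝓡 n) x))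
    (x : M) (a b c d : Fin n) : ℝ :=
  conformalWeyl B cov x (tangentFrame x a) (tangentFrame x b) (tangentFrame x c)
    (tangentFrame x d)

/-- The components `W_{ij}ᵏ_l` of the conformal Weyl tensor. -/
def conformalWeylMixed
    (B : (x : M) → TangentSpace (𝓡 n) x →L[ℝ] TangentSpace (𝓡 n) x →L[ℝ] ℝ)
    (cov : ((x : M) → TangentSpace (𝓡 n) x) →
      ((x : M) → TangentSpace (𝓡 n) x →L[ℝ] TangentSpace (𝓡 n) x))
    (x : M) (i j k l : Fin n) : ℝ :=
  ∑ c : Fin n, inverseMetric B x k c * conformalWeylComp B cov x i j c l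

/-- The components `W^{ij}_k^m` of the conformal Weyl tensor. -/
def conformalWeylRaised
    (B : (x : M) → TangentSpace (𝓡 n) x →L[ℝ] TangentSpace (𝓡 n) x →L[ℝ] ℝ)
    (cov : ((x : M) → TangentSpace (𝓡 n) x) →
      ((x : M) → TangentSpace (𝓡 n) x →L[ℝ] TangentSpace (𝓡 n) x))
    (x : M) (i j k m : Fin n) : ℝ :=
  ∑ a : Fin n, ∑ b : Fin n, ∑ d : Fin n,
    inverseMetric B x i a * inverseMetric B x j b * inverseMetric B x m d *
      conformalWeylComp B cov x a b k d

/-- `|W|² = g^{ia} g^{jb} g^{kc} g^{ld} W_{ijkl} W_{abcd}` for the conformal Weyl tensor. -/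
def conformalWeylNormSq
    (B : (x : M) → TangentSpace (𝓡 n) x →L[ℝ] TangentSpace (𝓡 n) x →L[ℝ] ℝ)
    (cov : ((x : M) → TangentSpace (𝓡 n) x) →
      ((x : M) → TangentSpace (𝓡 n) x →L[ℝ] TangentSpace (𝓡 n) x)) (x : M) : ℝ :=
  ∑ i : Fin n, ∑ j : Fin n, ∑ k : Fin n, ∑ l : Fin n,
    ∑ a : Fin n, ∑ b : Fin n, ∑ c : Fin n, ∑ d : Fin n,
      inverseMetric B x i a * inverseMetric B x j b * inverseMetric B x k c *
        inverseMetric B x l d * conformalWeylComp B cov x i j k l * conformalWeylComp B cov x a b c d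

/-- The conformal Weyl tensor is zero at the point `x`. -/
def ConformalWeylVanishesAt
    (B : (x : M) → TangentSpace (𝓡 n) x →L[ℝ] TangentSpace (𝓡 n) x →L[ℝ] ℝ)
    (cov : ((x : M) → TangentSpace (𝓡 n) x) →
      ((x : M) → TangentSpace (𝓡 n) x →L[ℝ] TangentSpace (𝓡 n) x)) (x : M) : Prop :=
  ∀ u v z w : TangentSpace (𝓡 n) x, conformalWeyl B cov x u v z w = 0

/-- The metric `B` is (locally) conformally flat on the open set `U`: every point of `U` has an
open neighbourhood in `U` on which some rescaling `φ • B`, with `φ` smooth and positive, is flat,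
that is, its Levi-Civita connection has zero curvature. -/
def IsConformallyFlatOn
    (B : (x : M) → TangentSpace (𝓡 n) x →L[ℝ] TangentSpace (𝓡 n) x →L[ℝ] ℝ)
    (U : Set M) : Prop :=
  ∀ x ∈ U, ∃ V : Set M, IsOpen V ∧ x ∈ V ∧ V ⊆ U ∧
    ∃ φ : M → ℝ, ContMDiffOn (𝓡 n) 𝓘(ℝ, ℝ) ∞ φ V ∧ (∀ y ∈ V, 0 < φ y) ∧
      ∃ cov : ((y : M) → TangentSpace (𝓡 n) y) →
          ((y : M) → TangentSpace (𝓡 n) y →L[ℝ] TangentSpace (𝓡 n) y),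
        IsLeviCivitaOn (fun y ↦ φ y • B y) cov V ∧
          ∀ y ∈ V, ∀ u v w : TangentSpace (𝓡 n) y, curvature cov y u v w = 0

end

end

/-!
At a point of a Ricci-flat pseudo-Riemannian manifold the projective and the conformal Weyl tensors
are both equal to the curvature tensor `R`. For a torsion-free metric connection, `R` is tensorial
and satisfies the first Bianchi identity, the skew symmetry of its operators and the pair symmetry
(`curvatureField_bianchi`, `curvatureField_skew`, `curvatureField_pair`,
`curvatureField_eq_curvature`). Skew symmetry comes from differentiating `g(Z, W)` twice, which needs
`X (Y f) - Y (X f) = [X, Y] f` (`mvfderiv_mlieBracket`). With the vanishing of the Ricci tensor these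
are the symmetries of a Weyl tensor.

The identity `4 W_{ij}ᵏ_l W^{ij}_kᵐ = |W|² δᵐ_l` is then pointwise algebra. In an orthogonal basis an
algebraic Weyl tensor in dimension four has ten free components, and in terms of these the
vanishing of the off-diagonal entries of the contraction and the equality of its diagonal entries
are polynomial identities (`IsWeylTensor.contraction_zero_one`); a permutation of the basis carries
the entries with indices `0` and `1` to all others. Contraction with the inverse metric does not
depend on the basis (`exists_orthogonal_contraction`), which gives the identity in the coordinate
frame (`IsRicciFlatCurvature.four_mul_sum_mixed`).

If a covector `g(z, ·)` is in the kernel of the Weyl map, then the contraction identity gives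
`|W|² g(z, ·) = 0`, so weak genericity holds wherever `|W|² ≠ 0`. For a definite metric `|W|²` is zero
only if `W` is zero. If `W` vanishes on an open set, then the Ricci-flat metric is flat there and in
particular conformally flat; and the set where `W ≠ 0` is open
(`IsLeviCivitaOn.eventually_curvature_ne_zero`).

The example on `ℝ⁴` is `e^{6s} ds² + e^{4s} (dx² + dy²) + e^{-2s} dz²`, a Kasner metric in Riemannian
signature. Its Christoffel symbols are explicit, constant vector fields suffice to compute the
curvature from them, and `R(∂_s, ∂_x) ∂_s = -2 ∂_x` everywhere.
-/

noncomputable section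

/-! ### Algebraic Weyl tensors in dimension four -/

/-- Two terms with vanishing weighted sum are the opposite multiples of a common factor. -/
lemma exists_eq_mul_of_add_eq_zero {a c u v : ℝ} (hc : c ≠ 0) (h : a * u + c * v = 0) :
    ∃ x, u = c * x ∧ v = -(a * x) := by
  refine ⟨u / c, by field_simp, ?_⟩
  field_simp
  linarith

/-- The components of an algebraic curvature tensor `W` in an orthogonal basis, with respect to
which the inverse metric is `diag η` and the Ricci tensor is zero. -/
structure IsWeylTensor (η : Fin 4 → ℝ) (W : Fin 4 → Fin 4 → Fin 4 → Fin 4 → ℝ) : Prop where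
  ne_zero : ∀ i, η i ≠ 0
  swap : ∀ a b c d, W a b c d = -W b a c d
  skew : ∀ a b c d, W a b c d = -W a b d c
  pair : ∀ a b c d, W a b c d = W c d a b
  bianchi : ∀ a b c d, W a b c d + W b d c a + W d a c b = 0
  trace : ∀ b d, ∑ a, η a * W a b a d = 0

namespace IsWeylTensor

variable {η : Fin 4 → ℝ} {W : Fin 4 → Fin 4 → Fin 4 → Fin 4 → ℝ}

/-- The two entries of the quadratic contraction that involve the first two basis vectors. The ten
free components of `W` are `k₀₁`, `k₀₂`, two components with four distinct indices and one component
`x` for each pair of indices; in terms of these both claims are polynomial identities. -/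
lemma contraction_zero_one (h : IsWeylTensor η W) :
    ∑ i, ∑ j, ∑ k, η i * η j * η k * (W i j k 0 * W i j k 1) = 0 ∧
    η 0 * ∑ i, ∑ j, ∑ k, η i * η j * η k * (W i j k 0 * W i j k 0) =
      η 1 * ∑ i, ∑ j, ∑ k, η i * η j * η k * (W i j k 1 * W i j k 1) := by
  have z1 : ∀ a c d, W a a c d = 0 := fun a c d ↦ by linarith [h.swap a a c d]
  have z2 : ∀ a b c, W a b c c = 0 := fun a b c ↦ by linarith [h.skew a b c c]
  have s10 := h.swap 1 0
  have s20 := h.swap 2 0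
  have s30 := h.swap 3 0
  have s21 := h.swap 2 1
  have s31 := h.swap 3 1
  have s32 := h.swap 3 2
  have t10 := fun a b ↦ h.skew a b 1 0
  have t20 := fun a b ↦ h.skew a b 2 0
  have t30 := fun a b ↦ h.skew a b 3 0
  have t21 := fun a b ↦ h.skew a b 2 1
  have t31 := fun a b ↦ h.skew a b 3 1
  have t32 := fun a b ↦ h.skew a b 3 2
  have p1 := h.pair 0 2 0 1
  have p2 := h.pair 0 3 0 1
  have p3 := h.pair 1 2 0 1
  have p4 := h.pair 1 3 0 1
  have p5 := h.pair 2 3 0 1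
  have p6 := h.pair 0 3 0 2
  have p7 := h.pair 1 2 0 2
  have p8 := h.pair 1 3 0 2
  have p9 := h.pair 2 3 0 2
  have p10 := h.pair 1 2 0 3
  have p11 := h.pair 1 3 0 3
  have p12 := h.pair 2 3 0 3
  have p13 := h.pair 1 3 1 2
  have p14 := h.pair 2 3 1 2
  have p15 := h.pair 2 3 1 3
  have r00 := h.trace 0 0
  have r11 := h.trace 1 1
  have r22 := h.trace 2 2
  have r33 := h.trace 3 3
  have r01 := h.trace 0 1
  have r02 := h.trace 0 2
  have r03 := h.trace 0 3
  have r12 := h.trace 1 2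
  have r13 := h.trace 1 3
  have r23 := h.trace 2 3
  have b := h.bianchi 0 1 2 3
  have n0 := h.ne_zero 0
  have n1 := h.ne_zero 1
  have n2 := h.ne_zero 2
  have n3 := h.ne_zero 3
  simp only [Fin.sum_univ_four, z1, z2, s10, s20, s30, s21, s31, s32, t10, t20, t30, t21, t31, t32,
    p1, p2, p3, p4, p5, p6, p7, p8, p9, p10, p11, p12, p13, p14, p15] at *
  obtain ⟨x01, e1, e2⟩ := exists_eq_mul_of_add_eq_zero (a := η 2) (c := η 3) (u := W 0 2 1 2)
    (v := W 0 3 1 3) n3 (by linarith)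
  obtain ⟨x02, e3, e4⟩ := exists_eq_mul_of_add_eq_zero (a := η 1) (c := η 3) (u := -W 0 1 1 2)
    (v := W 0 3 2 3) n3 (by linarith)
  obtain ⟨x03, e5, e6⟩ := exists_eq_mul_of_add_eq_zero (a := η 1) (c := η 2) (u := W 0 1 1 3)
    (v := W 0 2 2 3) n2 (by linarith)
  obtain ⟨x12, e7, e8⟩ := exists_eq_mul_of_add_eq_zero (a := η 0) (c := η 3) (u := W 0 1 0 2)
    (v := W 1 3 2 3) n3 (by linarith)
  obtain ⟨x13, e9, e10⟩ := exists_eq_mul_of_add_eq_zero (a := η 0) (c := η 2) (u := W 0 1 0 3)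
    (v := -W 1 2 2 3) n2 (by linarith)
  obtain ⟨x23, e11, e12⟩ := exists_eq_mul_of_add_eq_zero (a := η 0) (c := η 1) (u := W 0 2 0 3)
    (v := W 1 2 1 3) n1 (by linarith)
  have div : ∀ c d w : ℝ, c ≠ 0 → d ≠ 0 → ∃ k, w = c * d * k :=
    fun c d w hc hd ↦ ⟨w / (c * d), by field_simp⟩
  obtain ⟨k01, f1⟩ := div (η 2) (η 3) (W 0 1 0 1) n2 n3
  obtain ⟨k02, f2⟩ := div (η 1) (η 3) (W 0 2 0 2) n1 n3
  obtain ⟨k03, f3⟩ := div (η 1) (η 2) (W 0 3 0 3) n1 n2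
  obtain ⟨k12, f4⟩ := div (η 0) (η 3) (W 1 2 1 2) n0 n3
  obtain ⟨k13, f5⟩ := div (η 0) (η 2) (W 1 3 1 3) n0 n2
  obtain ⟨k23, f6⟩ := div (η 0) (η 1) (W 2 3 2 3) n0 n1
  rw [f1, f2, f3] at r00
  rw [f1, f4, f5] at r11
  rw [f2, f4, f6] at r22
  rw [f3, f5, f6] at r33
  have c0 : k01 + k02 + k03 = 0 := by
    have : η 1 * η 2 * η 3 * (k01 + k02 + k03) = 0 := by linear_combination r00
    simpa [n1, n2, n3] using this
  have c1 : k01 + k12 + k13 = 0 := by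
    have : η 0 * η 2 * η 3 * (k01 + k12 + k13) = 0 := by linear_combination r11
    simpa [n0, n2, n3] using this
  have c2 : k02 + k12 + k23 = 0 := by
    have : η 0 * η 1 * η 3 * (k02 + k12 + k23) = 0 := by linear_combination r22
    simpa [n0, n1, n3] using this
  have c3 : k03 + k13 + k23 = 0 := by
    have : η 0 * η 1 * η 2 * (k03 + k13 + k23) = 0 := by linear_combination r33
    simpa [n0, n1, n2] using this
  have k13e : k13 = k02 := by linarith
  have k03e : k03 = -k01 - k02 := by linarith
  have k12e : k12 = -k01 - k02 := by linarith
  rw [k13e] at f5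
  rw [k03e] at f3
  rw [k12e] at f4
  have e3' : W 0 1 1 2 = -(η 3 * x02) := by linarith
  have e10' : W 1 2 2 3 = η 0 * x13 := by linarith
  have b' : W 0 3 1 2 = W 0 2 1 3 - W 0 1 2 3 := by linarith
  simp only [e1, e2, e3', e4, e5, e6, e7, e8, e9, e10', e11, e12, f1, f2, f3, f4, f5, b']
  constructor <;> ring

lemma comp (h : IsWeylTensor η W) (σ : Equiv.Perm (Fin 4)) :
    IsWeylTensor (η ∘ σ) fun a b c d ↦ W (σ a) (σ b) (σ c) (σ d) where
  ne_zero i := h.ne_zero _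
  swap _ _ _ _ := h.swap ..
  skew _ _ _ _ := h.skew ..
  pair _ _ _ _ := h.pair ..
  bianchi _ _ _ _ := h.bianchi ..
  trace b d := by
    rw [← h.trace (σ b) (σ d)]
    exact Equiv.sum_comp σ fun a ↦ η a * W a (σ b) a (σ d)

lemma contraction_of_ne (h : IsWeylTensor η W) {l m : Fin 4} (hlm : l ≠ m) :
    ∑ i, ∑ j, ∑ k, η i * η j * η k * (W i j k l * W i j k m) = 0 ∧
    η l * ∑ i, ∑ j, ∑ k, η i * η j * η k * (W i j k l * W i j k l) =
      η m * ∑ i, ∑ j, ∑ k, η i * η j * η k * (W i j k m * W i j k m) := by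
  obtain ⟨σ, rfl, rfl⟩ : ∃ σ : Equiv.Perm (Fin 4), σ 0 = l ∧ σ 1 = m := by
    revert l m; decide
  have sum : ∀ f : Fin 4 → Fin 4 → Fin 4 → ℝ,
      ∑ i, ∑ j, ∑ k, f (σ i) (σ j) (σ k) = ∑ i, ∑ j, ∑ k, f i j k := by
    intro f
    rw [← Equiv.sum_comp σ fun i ↦ ∑ j, ∑ k, f i j k]
    refine Finset.sum_congr rfl fun i _ ↦ ?_
    rw [← Equiv.sum_comp σ fun j ↦ ∑ k, f (σ i) j k]
    exact Finset.sum_congr rfl fun j _ ↦ Equiv.sum_comp σ fun k ↦ f (σ i) (σ j) k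
  have := (h.comp σ).contraction_zero_one
  simp only [Function.comp_apply] at this
  rwa [sum fun i j k ↦ η i * η j * η k * (W i j k (σ 0) * W i j k (σ 1)),
    sum fun i j k ↦ η i * η j * η k * (W i j k (σ 0) * W i j k (σ 0)),
    sum fun i j k ↦ η i * η j * η k * (W i j k (σ 1) * W i j k (σ 1))] at this

/-- In dimension four the contraction of `W ⊗ W` over three indices is a multiple of the metric,
and the multiple is a quarter of the square norm of `W`. -/
theorem four_mul_contraction (h : IsWeylTensor η W) (l m : Fin 4) :
    4 * ∑ i, ∑ j, ∑ k, η i * η j * η k * (W i j k l * W i j k m) =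
      (∑ i, ∑ j, ∑ k, ∑ s, η i * η j * η k * η s * (W i j k s * W i j k s)) *
        if m = l then (η l)⁻¹ else 0 := by
  split_ifs with hm
  · subst hm
    have hs : ∑ i, ∑ j, ∑ k, ∑ s, η i * η j * η k * η s * (W i j k s * W i j k s) =
        ∑ s, η s * ∑ i, ∑ j, ∑ k, η i * η j * η k * (W i j k s * W i j k s) := by
      simp only [Fin.sum_univ_four]
      ring
    have hc : ∀ s, η s * ∑ i, ∑ j, ∑ k, η i * η j * η k * (W i j k s * W i j k s) =
        η m * ∑ i, ∑ j, ∑ k, η i * η j * η k * (W i j k m * W i j k m) := by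
      intro s
      by_cases hsm : s = m
      · rw [hsm]
      · exact (h.contraction_of_ne hsm).2
    rw [hs, Finset.sum_congr rfl fun s _ ↦ hc s, Finset.sum_const, Finset.card_univ,
      Fintype.card_fin, nsmul_eq_mul]
    have := h.ne_zero m
    field_simp
    push_cast
    ring
  · rw [(h.contraction_of_ne (Ne.symm hm)).1]
    simp

end IsWeylTensor

section Contraction

variable {V : Type*} [AddCommGroup V] [Module ℝ V]

/-- Contraction with the inverse metric, computed in a basis `e` or in an orthogonal basis `e'`. -/
lemma exists_orthogonal_contraction (g : LinearMap.BilinForm ℝ V) (hs : ∀ v w, g v w = g w v)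
    (hn : ∀ v, (∀ w, g v w = 0) → v = 0) {m : ℕ} (e : Module.Basis (Fin m) ℝ V) :
    ∃ (e' : Module.Basis (Fin m) ℝ V) (η : Fin m → ℝ), (∀ p, η p ≠ 0) ∧
      (∀ p q, g (e' p) (e' q) = if p = q then (η p)⁻¹ else 0) ∧
      ∀ L : V →ₗ[ℝ] V →ₗ[ℝ] ℝ,
        ∑ a, ∑ b, (Matrix.of fun a b ↦ g (e a) (e b))⁻¹ a b * L (e a) (e b) =
          ∑ p, η p * L (e' p) (e' p) := by
  have : FiniteDimensional ℝ V := e.finiteDimensional_of_finite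
  have hm : Module.finrank ℝ V = m := by rw [Module.finrank_eq_card_basis e, Fintype.card_fin]
  subst hm
  obtain ⟨e', ho⟩ := LinearMap.BilinForm.exists_orthogonal_basis (B := g) ⟨fun v w ↦ hs v w⟩
  have h0 : ∀ p q, p ≠ q → g (e' p) (e' q) = 0 := fun p q hpq ↦ ho hpq
  have hd : ∀ p, g (e' p) (e' p) ≠ 0 := by
    intro p hp
    refine e'.ne_zero p (hn _ fun w ↦ ?_)
    rw [← e'.sum_repr w, map_sum]
    refine Finset.sum_eq_zero fun q _ ↦ ?_
    rw [map_smul]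
    by_cases hpq : p = q
    · rw [← hpq, hp, smul_zero]
    · rw [h0 p q hpq, smul_zero]
  refine ⟨e', fun p ↦ (g (e' p) (e' p))⁻¹, fun p ↦ inv_ne_zero (hd p), fun p q ↦ ?_, fun L ↦ ?_⟩
  · split_ifs with hpq
    · rw [← hpq, inv_inv]
    · exact h0 p q hpq
  · set P : Matrix _ _ ℝ := e.toMatrix e' with hP
    set G : Matrix _ _ ℝ := Matrix.of fun a b ↦ g (e a) (e b) with hG
    have he : ∀ p, e' p = ∑ a, P a p • e a := fun p ↦ (e.sum_toMatrix_smul_self e' p).symm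
    have h1 : P.transpose * G * P = Matrix.diagonal fun p ↦ g (e' p) (e' p) := by
      ext p q
      have : g (e' p) (e' q) = (P.transpose * G * P) p q := by
        rw [he p, he q]
        simp only [map_sum, map_smul, LinearMap.sum_apply, LinearMap.smul_apply, smul_eq_mul,
          Matrix.mul_apply, Matrix.transpose_apply, hG, Matrix.of_apply, Finset.sum_mul]
        refine Finset.sum_congr rfl fun b _ ↦ ?_
        rw [Finset.mul_sum]
        refine Finset.sum_congr rfl fun a _ ↦ ?_
        ring
      rw [← this, Matrix.diagonal_apply]
      split_ifs with hpq
      · rw [hpq]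
      · exact h0 p q hpq
    have h2 : (Matrix.diagonal (fun p ↦ (g (e' p) (e' p))⁻¹) * P.transpose * G) * P = 1 := by
      rw [Matrix.mul_assoc, Matrix.mul_assoc, ← Matrix.mul_assoc P.transpose, h1,
        Matrix.diagonal_mul_diagonal, ← Matrix.diagonal_one]
      congr 1
      ext p
      exact inv_mul_cancel₀ (hd p)
    have h3 : G⁻¹ = P * Matrix.diagonal (fun p ↦ (g (e' p) (e' p))⁻¹) * P.transpose := by
      refine Matrix.inv_eq_left_inv ?_
      rw [Matrix.mul_assoc, Matrix.mul_assoc, ← Matrix.mul_assoc (Matrix.diagonal _)]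
      exact mul_eq_one_comm.1 h2
    have h4 : ∀ p, L (e' p) (e' p) = ∑ a, ∑ b, P a p * P b p * L (e a) (e b) := by
      intro p
      rw [he p]
      simp only [map_sum, map_smul, LinearMap.sum_apply, LinearMap.smul_apply, smul_eq_mul,
        Finset.mul_sum]
      rw [Finset.sum_comm]
      refine Finset.sum_congr rfl fun a _ ↦ Finset.sum_congr rfl fun b _ ↦ ?_
      ring
    simp only [h4, Finset.mul_sum, h3]
    symm
    rw [Finset.sum_comm]
    refine Finset.sum_congr rfl fun a _ ↦ ?_
    rw [Finset.sum_comm]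
    refine Finset.sum_congr rfl fun b _ ↦ ?_
    rw [Matrix.mul_apply, Finset.sum_mul]
    refine Finset.sum_congr rfl fun p _ ↦ ?_
    rw [Matrix.mul_diagonal, Matrix.transpose_apply]
    ring

/-- The inverse of the Gram matrix of the bilinear form `g` in the basis `e`. -/
def inverseGram (g : LinearMap.BilinForm ℝ V) {m : ℕ} (e : Module.Basis (Fin m) ℝ V) :
    Matrix (Fin m) (Fin m) ℝ :=
  (Matrix.of fun a b ↦ g (e a) (e b))⁻¹

lemma inverseGram_symm {g : LinearMap.BilinForm ℝ V} (hs : ∀ v w, g v w = g w v) {m : ℕ}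
    {e : Module.Basis (Fin m) ℝ V} (a b : Fin m) : inverseGram g e a b = inverseGram g e b a := by
  have : (Matrix.of fun a b ↦ g (e a) (e b)).transpose = Matrix.of fun a b ↦ g (e a) (e b) := by
    ext a b
    exact hs _ _
  have h2 := Matrix.transpose_nonsing_inv (Matrix.of fun a b ↦ g (e a) (e b))
  rw [this] at h2
  exact congr_fun (congr_fun h2 b) a

lemma sum_inverseGram_mul {g : LinearMap.BilinForm ℝ V} (hs : ∀ v w, g v w = g w v)
    (hn : ∀ v, (∀ w, g v w = 0) → v = 0) {m : ℕ} {e : Module.Basis (Fin m) ℝ V} (a b : Fin m) :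
    ∑ d, inverseGram g e b d * g (e a) (e d) = if b = a then 1 else 0 := by
  have hdet : IsUnit (Matrix.of fun a b ↦ g (e a) (e b)).det := by
    refine isUnit_iff_ne_zero.2 fun h0 ↦ ?_
    obtain ⟨v, hv0, hv⟩ := Matrix.exists_vecMul_eq_zero_iff.2 h0
    refine hv0 (funext fun i ↦ ?_)
    have : ∑ a, v a • e a = 0 := by
      refine hn _ fun w ↦ ?_
      rw [← e.sum_repr w, map_sum]
      refine Finset.sum_eq_zero fun b _ ↦ ?_
      have := congr_fun hv b
      simp only [Matrix.vecMul, dotProduct, Matrix.of_apply, Pi.zero_apply] at this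
      simp [this]
    exact Fintype.linearIndependent_iff.1 e.linearIndependent v this i
  have := congr_fun (congr_fun (Matrix.nonsing_inv_mul _ hdet) b) a
  rw [Matrix.mul_apply, Matrix.one_apply] at this
  rw [← this]
  exact Finset.sum_congr rfl fun d _ ↦ by rw [hs]; rfl

/-- The symmetries of the Weyl tensor of a Ricci-flat metric on a vector space with a basis `e`, for
a form `T` that is linear in each of its four arguments. -/
structure IsRicciFlatCurvature (g : LinearMap.BilinForm ℝ V) (e : Module.Basis (Fin 4) ℝ V)
    (T : V →ₗ[ℝ] V →ₗ[ℝ] V →ₗ[ℝ] V →ₗ[ℝ] ℝ) : Prop where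
  symm : ∀ v w, g v w = g w v
  nondegenerate : ∀ v, (∀ w, g v w = 0) → v = 0
  swap : ∀ u v z w, T u v z w = -T v u z w
  skew : ∀ u v z w, T u v z w = -T u v w z
  pair : ∀ u v z w, T u v z w = T z w u v
  bianchi : ∀ u v z w, T u v z w + T v w z u + T w u z v = 0
  trace : ∀ v w, ∑ a, ∑ b, inverseGram g e a b * T (e a) v (e b) w = 0

/-- The square norm of the tensor `T`, as a contraction over four pairs of indices. -/
def tensorNormSq (g : LinearMap.BilinForm ℝ V) (e : Module.Basis (Fin 4) ℝ V)
    (T : V →ₗ[ℝ] V →ₗ[ℝ] V →ₗ[ℝ] V →ₗ[ℝ] ℝ) : ℝ :=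
  ∑ i, ∑ j, ∑ k, ∑ l, ∑ a, ∑ b, ∑ c, ∑ d,
    inverseGram g e i a * inverseGram g e j b * inverseGram g e k c * inverseGram g e l d *
      T (e i) (e j) (e k) (e l) * T (e a) (e b) (e c) (e d)

variable {g : LinearMap.BilinForm ℝ V} {e : Module.Basis (Fin 4) ℝ V}
  {T : V →ₗ[ℝ] V →ₗ[ℝ] V →ₗ[ℝ] V →ₗ[ℝ] ℝ}

/-- Contraction of the first three indices of `T ⊗ T`. -/
lemma sum_contraction_three {η : Fin 4 → ℝ} {e' : Fin 4 → V}
    (hc : ∀ L : V →ₗ[ℝ] V →ₗ[ℝ] ℝ, ∑ a, ∑ b, inverseGram g e a b * L (e a) (e b) =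
      ∑ p, η p * L (e' p) (e' p)) (w z : V) :
    ∑ i, ∑ a, inverseGram g e i a * ∑ j, ∑ b, inverseGram g e j b * ∑ k, ∑ c,
      inverseGram g e k c * (T (e i) (e j) (e k) w * T (e a) (e b) (e c) z) =
    ∑ p, ∑ q, ∑ r, η p * η q * η r * (T (e' p) (e' q) (e' r) w * T (e' p) (e' q) (e' r) z) := by
  have h1 : ∀ i j a b, ∑ k, ∑ c,
      inverseGram g e k c * (T (e i) (e j) (e k) w * T (e a) (e b) (e c) z) =
      ∑ r, η r * (T (e i) (e j) (e' r) w * T (e a) (e b) (e' r) z) := fun i j a b ↦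
    hc (((T (e i) (e j)).flip w).smulRight ((T (e a) (e b)).flip z))
  have h2 : ∀ i a, ∑ j, ∑ b, inverseGram g e j b *
      ∑ r, η r * (T (e i) (e j) (e' r) w * T (e a) (e b) (e' r) z) =
      ∑ q, η q * ∑ r, η r * (T (e i) (e' q) (e' r) w * T (e a) (e' q) (e' r) z) := fun i a ↦ by
    simpa using hc (∑ r, η r • (((T (e i)).flip (e' r)).flip w).smulRight
      (((T (e a)).flip (e' r)).flip z))
  have h3 : ∑ i, ∑ a, inverseGram g e i a *
      ∑ q, η q * ∑ r, η r * (T (e i) (e' q) (e' r) w * T (e a) (e' q) (e' r) z) =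
      ∑ p, η p * ∑ q, η q * ∑ r, η r *
        (T (e' p) (e' q) (e' r) w * T (e' p) (e' q) (e' r) z) := by
    simpa using hc (∑ q, η q • ∑ r, η r • (((T.flip (e' q)).flip (e' r)).flip w).smulRight
      (((T.flip (e' q)).flip (e' r)).flip z))
  simp only [h1, h2, h3]
  simp only [Finset.mul_sum, mul_assoc]

lemma sum_comm_last {α : Type*} [Fintype α] (f : α → α → α → ℝ) :
    ∑ k, ∑ l, ∑ a, f k l a = ∑ a, ∑ k, ∑ l, f k l a :=
  (Finset.sum_congr rfl fun _ _ ↦ Finset.sum_comm).trans Finset.sum_comm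

lemma sum_comm_last₄ {α : Type*} [Fintype α] (f : α → α → α → α → ℝ) :
    ∑ j, ∑ k, ∑ l, ∑ a, f j k l a = ∑ a, ∑ j, ∑ k, ∑ l, f j k l a :=
  (Finset.sum_congr rfl fun _ _ ↦ sum_comm_last _).trans Finset.sum_comm

lemma tensorNormSq_eq {η : Fin 4 → ℝ} {e' : Fin 4 → V}
    (hc : ∀ L : V →ₗ[ℝ] V →ₗ[ℝ] ℝ, ∑ a, ∑ b, inverseGram g e a b * L (e a) (e b) =
      ∑ p, η p * L (e' p) (e' p)) :
    tensorNormSq g e T = ∑ p, ∑ q, ∑ r, ∑ s, η p * η q * η r * η s *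
      (T (e' p) (e' q) (e' r) (e' s) * T (e' p) (e' q) (e' r) (e' s)) := by
  have h1 : tensorNormSq g e T = ∑ l, ∑ d, inverseGram g e l d *
      ∑ i, ∑ a, inverseGram g e i a * ∑ j, ∑ b, inverseGram g e j b * ∑ k, ∑ c,
      inverseGram g e k c * (T (e i) (e j) (e k) (e l) * T (e a) (e b) (e c) (e d)) := by
    simp only [tensorNormSq, Finset.mul_sum]
    rw [sum_comm_last₄]
    refine Finset.sum_congr rfl fun l _ ↦ ?_
    symm
    rw [Finset.sum_comm]
    refine Finset.sum_congr rfl fun i _ ↦ ?_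
    rw [Finset.sum_comm]
    refine Eq.trans (Finset.sum_congr rfl fun a _ ↦ ?_) (sum_comm_last _).symm
    rw [Finset.sum_comm]
    refine Finset.sum_congr rfl fun j _ ↦ ?_
    rw [Finset.sum_comm]
    refine Eq.trans (Finset.sum_congr rfl fun b _ ↦ ?_) Finset.sum_comm
    rw [Finset.sum_comm]
    refine Finset.sum_congr rfl fun k _ ↦ ?_
    rw [Finset.sum_comm]
    refine Finset.sum_congr rfl fun c _ ↦ Finset.sum_congr rfl fun d _ ↦ ?_
    ring
  have h2 : ∑ l, ∑ d, inverseGram g e l d * ∑ p, ∑ q, ∑ r, η p * η q * η r *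
        (T (e' p) (e' q) (e' r) (e l) * T (e' p) (e' q) (e' r) (e d)) =
      ∑ s, η s * ∑ p, ∑ q, ∑ r, η p * η q * η r *
        (T (e' p) (e' q) (e' r) (e' s) * T (e' p) (e' q) (e' r) (e' s)) := by
    simpa using hc (∑ p, ∑ q, ∑ r, (η p * η q * η r) •
      (T (e' p) (e' q) (e' r)).smulRight (T (e' p) (e' q) (e' r)))
  simp only [h1, sum_contraction_three hc, h2]
  simp only [Finset.mul_sum]
  rw [← sum_comm_last₄]
  refine Finset.sum_congr rfl fun p _ ↦ Finset.sum_congr rfl fun q _ ↦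
    Finset.sum_congr rfl fun r _ ↦ Finset.sum_congr rfl fun s _ ↦ ?_
  ring

namespace IsRicciFlatCurvature

/-- In an orthogonal basis, the tensor satisfies the hypotheses of
`IsWeylTensor.four_mul_contraction`. -/
lemma exists_isWeylTensor (h : IsRicciFlatCurvature g e T) :
    ∃ (e' : Module.Basis (Fin 4) ℝ V) (η : Fin 4 → ℝ),
      IsWeylTensor η (fun p q r s ↦ T (e' p) (e' q) (e' r) (e' s)) ∧
      (∀ p q, g (e' p) (e' q) = if p = q then (η p)⁻¹ else 0) ∧
      ∀ L : V →ₗ[ℝ] V →ₗ[ℝ] ℝ,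
        ∑ a, ∑ b, inverseGram g e a b * L (e a) (e b) = ∑ p, η p * L (e' p) (e' p) := by
  obtain ⟨e', η, h0, hg, hc⟩ := exists_orthogonal_contraction g h.symm h.nondegenerate e
  refine ⟨e', η, ⟨h0, fun _ _ _ _ ↦ h.swap .., fun _ _ _ _ ↦ h.skew .., fun _ _ _ _ ↦ h.pair ..,
    fun _ _ _ _ ↦ h.bianchi .., fun b d ↦ ?_⟩, hg, hc⟩
  exact (hc ((T.flip (e' b)).compr₂ (LinearMap.applyₗ (e' d)))).symm.trans (h.trace _ _)

/-- The contraction of three indices of `T ⊗ T` is a multiple of the metric. -/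
theorem four_mul_sum_contraction (h : IsRicciFlatCurvature g e T) (w z : V) :
    4 * ∑ i, ∑ a, inverseGram g e i a * ∑ j, ∑ b, inverseGram g e j b * ∑ k, ∑ c,
      inverseGram g e k c * (T (e i) (e j) (e k) w * T (e a) (e b) (e c) z) =
    tensorNormSq g e T * g w z := by
  obtain ⟨e', η, hW, hg, hc⟩ := h.exists_isWeylTensor
  rw [sum_contraction_three hc, tensorNormSq_eq hc]
  set N := ∑ p, ∑ q, ∑ r, ∑ s, η p * η q * η r * η s *
      (T (e' p) (e' q) (e' r) (e' s) * T (e' p) (e' q) (e' r) (e' s))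
  have : (4 : ℝ) • ∑ p, ∑ q, ∑ r, (η p * η q * η r) •
      (T (e' p) (e' q) (e' r)).smulRight (T (e' p) (e' q) (e' r)) = N • g := by
    refine LinearMap.ext_basis e' e' fun l m ↦ ?_
    have := hW.four_mul_contraction l m
    simp only [eq_comm (a := m)] at this
    simpa [hg] using this
  simpa using LinearMap.congr_fun₂ this w z

/-- Wherever the square norm of `T` is not zero, contraction of the third slot with a vector is
injective. -/
theorem eq_zero_of_forall_eq_zero (h : IsRicciFlatCurvature g e T) (hN : tensorNormSq g e T ≠ 0)
    {z : V} (hz : ∀ u v w, T u v z w = 0) : z = 0 := by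
  refine h.nondegenerate z fun w ↦ ?_
  have := h.four_mul_sum_contraction z w
  simp only [h.skew _ _ _ z, hz] at this
  simpa [hN] using this

/-- For a definite metric the square norm vanishes only for the zero tensor. -/
theorem eq_zero_of_tensorNormSq_eq_zero (h : IsRicciFlatCurvature g e T)
    (hpos : ∀ v, v ≠ 0 → 0 < g v v) (hN : tensorNormSq g e T = 0) : T = 0 := by
  obtain ⟨e', η, hW, hg, hc⟩ := h.exists_isWeylTensor
  have hη : ∀ p, 0 < η p := fun p ↦ by
    have := hpos _ (e'.ne_zero p)
    rwa [hg, if_pos rfl, inv_pos] at this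
  rw [tensorNormSq_eq hc] at hN
  have nn : ∀ p q r s, 0 ≤ η p * η q * η r * η s *
      (T (e' p) (e' q) (e' r) (e' s) * T (e' p) (e' q) (e' r) (e' s)) := fun p q r s ↦
    mul_nonneg (mul_pos (mul_pos (mul_pos (hη p) (hη q)) (hη r)) (hη s)).le (mul_self_nonneg _)
  refine e'.ext fun p ↦ e'.ext fun q ↦ e'.ext fun r ↦ e'.ext fun s ↦ ?_
  rw [Finset.sum_eq_zero_iff_of_nonneg fun p _ ↦ Finset.sum_nonneg fun q _ ↦
    Finset.sum_nonneg fun r _ ↦ Finset.sum_nonneg fun s _ ↦ nn p q r s] at hN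
  have hN := hN p (Finset.mem_univ p)
  rw [Finset.sum_eq_zero_iff_of_nonneg fun q _ ↦
    Finset.sum_nonneg fun r _ ↦ Finset.sum_nonneg fun s _ ↦ nn p q r s] at hN
  have hN := hN q (Finset.mem_univ q)
  rw [Finset.sum_eq_zero_iff_of_nonneg fun r _ ↦ Finset.sum_nonneg fun s _ ↦ nn p q r s] at hN
  have hN := hN r (Finset.mem_univ r)
  rw [Finset.sum_eq_zero_iff_of_nonneg fun s _ ↦ nn p q r s] at hN
  have hN := hN s (Finset.mem_univ s)
  simpa [(hη _).ne'] using hN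

/-- The index form of `four_mul_sum_contraction`. -/
theorem four_mul_sum_mixed (h : IsRicciFlatCurvature g e T) (l m : Fin 4) :
    4 * ∑ i, ∑ j, ∑ k, (∑ c, inverseGram g e k c * T (e i) (e j) (e c) (e l)) *
      (∑ a, ∑ b, ∑ d, inverseGram g e i a * inverseGram g e j b * inverseGram g e m d *
        T (e a) (e b) (e k) (e d)) =
    tensorNormSq g e T * if m = l then 1 else 0 := by
  have h1 : (tensorNormSq g e T * if m = l then 1 else 0) = 4 * ∑ d, inverseGram g e m d *
      ∑ i, ∑ a, inverseGram g e i a * ∑ j, ∑ b, inverseGram g e j b * ∑ k, ∑ c,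
      inverseGram g e k c * (T (e i) (e j) (e k) (e l) * T (e a) (e b) (e c) (e d)) := by
    rw [← sum_inverseGram_mul h.symm h.nondegenerate, Finset.mul_sum, Finset.mul_sum]
    refine Finset.sum_congr rfl fun d _ ↦ ?_
    rw [mul_left_comm, ← h.four_mul_sum_contraction, mul_left_comm]
  rw [h1]
  congr 1
  simp only [Finset.mul_sum]
  symm
  rw [Finset.sum_comm]
  refine Finset.sum_congr rfl fun i _ ↦ ?_
  rw [Finset.sum_comm]
  simp only [Finset.sum_mul]
  refine Eq.trans (Finset.sum_congr rfl fun a _ ↦ ?_) (sum_comm_last _).symm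
  rw [Finset.sum_comm]
  refine Finset.sum_congr rfl fun j _ ↦ ?_
  rw [Finset.sum_comm]
  refine Eq.trans (Finset.sum_congr rfl fun b _ ↦ ?_) Finset.sum_comm
  refine Eq.trans (Finset.sum_congr rfl fun d _ ↦ ?_) Finset.sum_comm
  -- the two factors carry the contracted pair of indices in opposite order
  rw [Finset.sum_comm]
  refine Finset.sum_congr rfl fun k _ ↦ Finset.sum_congr rfl fun c _ ↦ ?_
  rw [inverseGram_symm h.symm c k]
  ring

end IsRicciFlatCurvature

end Contraction

/-! ### Smooth vector fields and the Lie bracket -/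

section SmoothFields

variable {n : ℕ} {M : Type u} [TopologicalSpace M]
  [ChartedSpace (EuclideanSpace ℝ (Fin n)) M] [IsManifold (𝓡 n) ∞ M]

/-- The vector field `X` is smooth on a neighbourhood of `x`. -/
def IsSmoothFieldNear (X : (x : M) → TangentSpace (𝓡 n) x) (x : M) : Prop :=
  ∀ᶠ y in 𝓝 x, ContMDiffAt (𝓡 n) ((𝓡 n).prod 𝓘(ℝ, EuclideanSpace ℝ (Fin n))) ∞
    (fun y ↦ (⟨y, X y⟩ : TotalSpace (EuclideanSpace ℝ (Fin n)) (TangentSpace (𝓡 n) : M → Type))) y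

namespace IsSmoothFieldNear

variable {X Y : (x : M) → TangentSpace (𝓡 n) x} {x : M}

lemma contMDiffAt (hX : IsSmoothFieldNear X x) :
    ContMDiffAt (𝓡 n) ((𝓡 n).prod 𝓘(ℝ, EuclideanSpace ℝ (Fin n))) ∞
      (fun y ↦ (⟨y, X y⟩ :
        TotalSpace (EuclideanSpace ℝ (Fin n)) (TangentSpace (𝓡 n) : M → Type))) x :=
  hX.self_of_nhds

lemma isDifferentiableFieldAt (hX : IsSmoothFieldNear X x) : IsDifferentiableFieldAt X x :=
  hX.contMDiffAt.mdifferentiableAt (by simp)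

lemma eventually (hX : IsSmoothFieldNear X x) : ∀ᶠ y in 𝓝 x, IsSmoothFieldNear X y :=
  eventually_eventually_nhds.2 hX

lemma extend (v : TangentSpace (𝓡 n) x) :
    IsSmoothFieldNear (FiberBundle.extend (EuclideanSpace ℝ (Fin n)) v) x := by
  obtain ⟨s, hs, h⟩ := FiberBundle.exists_contMDiffOn_extend (k := ∞) (𝓡 n)
    (EuclideanSpace ℝ (Fin n)) (V := (TangentSpace (𝓡 n) : M → Type)) v
  filter_upwards [eventually_mem_nhds_iff.2 hs] with y hy
  exact h.contMDiffAt hy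

lemma sub (hX : IsSmoothFieldNear X x) (hY : IsSmoothFieldNear Y x) :
    IsSmoothFieldNear (X - Y) x := by
  filter_upwards [hX, hY] with y h1 h2
  exact h1.sub_section h2

lemma const_smul (c : ℝ) (hX : IsSmoothFieldNear X x) : IsSmoothFieldNear (c • X) x := by
  filter_upwards [hX] with y h1
  exact h1.const_smul_section

lemma mlieBracket (hX : IsSmoothFieldNear X x) (hY : IsSmoothFieldNear Y x) :
    IsSmoothFieldNear (VectorField.mlieBracket (𝓡 n) X Y) x := by
  filter_upwards [hX, hY] with y h1 h2
  have : IsManifold (𝓡 n) (((⊤ : ℕ∞) : WithTop ℕ∞) + 1) M := ‹IsManifold (𝓡 n) ∞ M›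
  have : IsManifold (𝓡 n) (minSmoothness ℝ 2) M :=
    IsManifold.of_le (n := ∞) (by simpa using ENat.LEInfty.out)
  exact ContMDiffAt.mlieBracket_vectorField (m := ⊤) (n := ⊤) h1 h2 (by simp)

/-- A vector field that is smooth near a point agrees near that point with a globally smooth
vector field. -/
lemma exists_contMDiff [T2Space M] (hX : IsSmoothFieldNear X x) :
    ∃ X' : (x : M) → TangentSpace (𝓡 n) x,
      ContMDiff (𝓡 n) ((𝓡 n).prod 𝓘(ℝ, EuclideanSpace ℝ (Fin n))) ∞
        (fun y ↦ (⟨y, X' y⟩ :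
          TotalSpace (EuclideanSpace ℝ (Fin n)) (TangentSpace (𝓡 n) : M → Type))) ∧
      ∀ᶠ y in 𝓝 x, X' y = X y := by
  obtain ⟨f, -, hf⟩ := (SmoothBumpFunction.nhds_basis_tsupport (I := 𝓡 n) x).mem_iff.1 hX
  refine ⟨(f : M → ℝ) • X, fun y ↦ ?_, ?_⟩
  · by_cases hy : y ∈ tsupport f
    · exact f.contMDiffAt.smul_section (hf hy)
    · have h0 := contMDiff_zeroSection ℝ (TangentSpace (𝓡 n) : M → Type) (n := ∞)
        (F := EuclideanSpace ℝ (Fin n)) (IB := 𝓡 n) y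
      refine ContMDiffAt.congr_of_eventuallyEq h0 ?_
      filter_upwards [(isClosed_tsupport f).isOpen_compl.mem_nhds hy] with z hz
      have : f z = 0 := image_eq_zero_of_notMem_tsupport hz
      simp [this, zeroSection]
  · filter_upwards [f.eventuallyEq_one] with y hy
    simp [hy]

end IsSmoothFieldNear

/-- The commutator of two vector fields, acting on functions, is their bracket. The identity is
read off from the Jacobi identity of `X`, `Y` and `f Z`, where `Z` does not vanish at `x`. -/
lemma mvfderiv_mlieBracket [NeZero n] {X Y : (x : M) → TangentSpace (𝓡 n) x} {x : M} {f : M → ℝ}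
    (hX : IsSmoothFieldNear X x) (hY : IsSmoothFieldNear Y x)
    (hf : ∀ᶠ y in 𝓝 x, ContMDiffAt (𝓡 n) 𝓘(ℝ, ℝ) ∞ f y)
    (hXf : MDifferentiableAt (𝓡 n) 𝓘(ℝ, ℝ) (fun y ↦ mvfderiv (𝓡 n) f y (X y)) x)
    (hYf : MDifferentiableAt (𝓡 n) 𝓘(ℝ, ℝ) (fun y ↦ mvfderiv (𝓡 n) f y (Y y)) x) :
    mvfderiv (𝓡 n) (fun y ↦ mvfderiv (𝓡 n) f y (Y y)) x (X x) -
        mvfderiv (𝓡 n) (fun y ↦ mvfderiv (𝓡 n) f y (X y)) x (Y x) =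
      mvfderiv (𝓡 n) f x (VectorField.mlieBracket (𝓡 n) X Y x) := by
  have hfd : ∀ᶠ y in 𝓝 x, MDifferentiableAt (𝓡 n) 𝓘(ℝ, ℝ) f y :=
    hf.mono fun y hy ↦ hy.mdifferentiableAt (by simp)
  have hI : IsManifold (𝓡 n) (minSmoothness ℝ 3) M :=
    IsManifold.of_le (n := ∞) (by simpa using ENat.LEInfty.out)
  have hI : IsManifold (𝓡 n) (minSmoothness ℝ 2) M :=
    IsManifold.of_le (n := ∞) (by simpa using ENat.LEInfty.out)
  have h2 : minSmoothness ℝ 2 ≤ ∞ := by simpa using ENat.LEInfty.out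
  set Z : (x : M) → TangentSpace (𝓡 n) x :=
    FiberBundle.extend (EuclideanSpace ℝ (Fin n)) (tangentFrame x 0)
  have hZ : IsSmoothFieldNear Z x := .extend _
  have hZx : Z x ≠ 0 := by
    intro h0
    rw [show Z x = tangentFrame x 0 from FiberBundle.extend_apply_self _ _] at h0
    have := congr_arg (fun v ↦ tangentCoord x v 0) h0
    change (EuclideanSpace.single (0 : Fin n) (1 : ℝ)) 0 = (0 : EuclideanSpace ℝ (Fin n)) 0 at this
    simp at this
  -- `[A, f Z] = (A f) Z + f [A, Z]` near `x`
  have key : ∀ A : (x : M) → TangentSpace (𝓡 n) x, VectorField.mlieBracket (𝓡 n) A (f • Z) =ᶠ[𝓝 x]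
      (fun y ↦ mvfderiv (𝓡 n) f y (A y)) • Z + f • VectorField.mlieBracket (𝓡 n) A Z := by
    intro A
    filter_upwards [hfd, hZ.eventually] with y h1 h2
    exact VectorField.mlieBracket_smul_right h1 h2.isDifferentiableFieldAt
  have key2 : ∀ A C : (x : M) → TangentSpace (𝓡 n) x, IsSmoothFieldNear A x →
      MDifferentiableAt (𝓡 n) 𝓘(ℝ, ℝ) (fun y ↦ mvfderiv (𝓡 n) f y (A y)) x →
      VectorField.mlieBracket (𝓡 n) C (VectorField.mlieBracket (𝓡 n) A (f • Z)) x =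
        mvfderiv (𝓡 n) (fun y ↦ mvfderiv (𝓡 n) f y (A y)) x (C x) • Z x +
          mvfderiv (𝓡 n) f x (A x) • VectorField.mlieBracket (𝓡 n) C Z x +
        (mvfderiv (𝓡 n) f x (C x) • VectorField.mlieBracket (𝓡 n) A Z x +
          f x • VectorField.mlieBracket (𝓡 n) C (VectorField.mlieBracket (𝓡 n) A Z) x) := by
    intro A C hA hAf
    have hAZ := (hA.mlieBracket hZ).isDifferentiableFieldAt
    have hZ' := hZ.isDifferentiableFieldAt
    rw [(Filter.EventuallyEq.refl _ C).mlieBracket_vectorField_eq (key A),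
      VectorField.mlieBracket_add_right (hAf.smul_section hZ') (hfd.self_of_nhds.smul_section hAZ),
      VectorField.mlieBracket_smul_right hAf hZ',
      VectorField.mlieBracket_smul_right hfd.self_of_nhds hAZ]
  have J0 := VectorField.leibniz_identity_mlieBracket_apply (hX.contMDiffAt.of_le h2)
    (hY.contMDiffAt.of_le h2) (hZ.contMDiffAt.of_le h2)
  have J1 := VectorField.leibniz_identity_mlieBracket_apply (hX.contMDiffAt.of_le h2)
    (hY.contMDiffAt.of_le h2) ((hf.self_of_nhds.smul_section hZ.contMDiffAt).of_le h2)
  rw [key2 _ _ hY hYf, key2 _ _ hX hXf, (key _).self_of_nhds, J0] at J1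
  simp only [Pi.add_apply, Pi.smul_apply'] at J1
  rw [← sub_eq_zero]
  refine (smul_eq_zero.1 ?_).resolve_right hZx
  rw [← sub_eq_zero] at J1
  rw [← J1]
  module

end SmoothFields

section

variable {n : ℕ} {M : Type u} [TopologicalSpace M] [T2Space M]
  [ChartedSpace (EuclideanSpace ℝ (Fin n)) M] [IsManifold (𝓡 n) ∞ M]
  {B : (x : M) → TangentSpace (𝓡 n) x →L[ℝ] TangentSpace (𝓡 n) x →L[ℝ] ℝ}
  {cov : ((x : M) → TangentSpace (𝓡 n) x) →
      ((x : M) → TangentSpace (𝓡 n) x →L[ℝ] TangentSpace (𝓡 n) x)}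
  {X Y : (x : M) → TangentSpace (𝓡 n) x} {x : M}

/-- A field that is smooth near `x` is replaced by a globally smooth one, as the smoothness of `cov`
on `univ` only concerns global fields. -/
lemma IsLeviCivitaOn.contMDiffAt_cov (h : IsLeviCivitaOn B cov univ) (hY : IsSmoothFieldNear Y x) :
    ContMDiffAt (𝓡 n)
      ((𝓡 n).prod 𝓘(ℝ, EuclideanSpace ℝ (Fin n) →L[ℝ] EuclideanSpace ℝ (Fin n))) ∞
      (fun y ↦ (⟨y, cov Y y⟩ : TotalSpace (EuclideanSpace ℝ (Fin n) →L[ℝ] EuclideanSpace ℝ (Fin n))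
        fun x : M ↦ TangentSpace (𝓡 n) x →L[ℝ] TangentSpace (𝓡 n) x)) x := by
  obtain ⟨Y', hY', he⟩ := hY.exists_contMDiff
  have h1 := h.smooth.contMDiff (σ := Y') (by simpa using! hY'.contMDiffOn)
  refine (h1.contMDiffAt Filter.univ_mem).congr_of_eventuallyEq ?_
  filter_upwards [hY.eventually, he.eventually_nhds] with y hy hy'
  have := h.isCovariantDerivativeOn.congr_of_eventuallyEq (σ := Y) (σ' := Y')
    hy.isDifferentiableFieldAt (hY'.mdifferentiableAt (by simp)) Filter.univ_mem
    (hy'.mono fun _ h ↦ h.symm)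
  rw [this]

lemma IsLeviCivitaOn.isSmoothFieldNear_cov (h : IsLeviCivitaOn B cov univ)
    (hX : IsSmoothFieldNear X x) (hY : IsSmoothFieldNear Y x) :
    IsSmoothFieldNear (fun y ↦ cov Y y (X y)) x := by
  filter_upwards [hX, hY.eventually] with y h1 h2
  exact (h.contMDiffAt_cov h2).clm_bundle_apply h1

/-! ### Symmetries of the curvature of a Levi-Civita connection -/

section

variable {n : ℕ} {M : Type u} [TopologicalSpace M] [ChartedSpace (EuclideanSpace ℝ (Fin n)) M]

lemma curvatureField_swap (cov : ((x : M) → TangentSpace (𝓡 n) x) →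
      ((x : M) → TangentSpace (𝓡 n) x →L[ℝ] TangentSpace (𝓡 n) x))
    (X Y Z : (x : M) → TangentSpace (𝓡 n) x) (x : M) :
    curvatureField cov X Y Z x = -curvatureField cov Y X Z x := by
  simp only [curvatureField]
  rw [VectorField.mlieBracket_swap_apply, map_neg]
  abel

lemma mvfderiv_congr {x : M} {f f' : M → ℝ} (h : f =ᶠ[𝓝 x] f') :
    mvfderiv (𝓡 n) f x = mvfderiv (𝓡 n) f' x := by
  ext v
  change (mfderiv (𝓡 n) 𝓘(ℝ, ℝ) f x v : ℝ) = mfderiv (𝓡 n) 𝓘(ℝ, ℝ) f' x v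
  rw [h.mfderiv_eq]
  rfl

variable [IsManifold (𝓡 n) ∞ M]

lemma curvature_swap (cov : ((x : M) → TangentSpace (𝓡 n) x) →
      ((x : M) → TangentSpace (𝓡 n) x →L[ℝ] TangentSpace (𝓡 n) x))
    (x : M) (u v w : TangentSpace (𝓡 n) x) :
    curvature cov x u v w = -curvature cov x v u w :=
  curvatureField_swap ..

end

section

variable {n : ℕ} {M : Type u} [TopologicalSpace M]
  [ChartedSpace (EuclideanSpace ℝ (Fin n)) M] [IsManifold (𝓡 n) ∞ M]
  {g : PseudoRiemannianMetric n M}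
  {cov : ((x : M) → TangentSpace (𝓡 n) x) →
      ((x : M) → TangentSpace (𝓡 n) x →L[ℝ] TangentSpace (𝓡 n) x)}
  {X Y Z W : (x : M) → TangentSpace (𝓡 n) x} {x : M}

lemma PseudoRiemannianMetric.contMDiffAt_apply (g : PseudoRiemannianMetric n M)
    (hX : IsSmoothFieldNear X x) (hY : IsSmoothFieldNear Y x) :
    ContMDiffAt (𝓡 n) 𝓘(ℝ, ℝ) ∞ (fun y ↦ g.form y (X y) (Y y)) x := by
  have : ContMDiffAt (𝓡 n) ((𝓡 n).prod 𝓘(ℝ)) ∞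
      (fun m ↦ TotalSpace.mk' ℝ (E := Bundle.Trivial M ℝ) m (g.form m (X m) (Y m))) x := by
    apply ContMDiffAt.clm_bundle_apply₂ (F₁ := EuclideanSpace ℝ (Fin n))
      (F₂ := EuclideanSpace ℝ (Fin n))
    · exact g.contMDiff.contMDiffAt
    · exact hX.contMDiffAt
    · exact hY.contMDiffAt
  simp only [contMDiffAt_totalSpace] at this
  exact this.2

namespace IsLeviCivitaOn

lemma cov_sub (h : IsLeviCivitaOn g.form cov univ) (hX : IsSmoothFieldNear X x)
    (hY : IsSmoothFieldNear Y x) : cov (X - Y) x = cov X x - cov Y x := by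
  have h1 := h.isCovariantDerivativeOn.smul_const (-1 : ℝ) hY.isDifferentiableFieldAt
  have h2 := h.isCovariantDerivativeOn.add (x := x) hX.isDifferentiableFieldAt
    (hY.const_smul (-1 : ℝ)).isDifferentiableFieldAt
  rw [sub_eq_add_neg, ← neg_one_smul ℝ Y, h2, h1]
  module

variable [T2Space M]

/-- The covariant derivative of `[X, Y] = ∇_X Y - ∇_Y X`. -/
lemma cov_mlieBracket (h : IsLeviCivitaOn g.form cov univ) (hX : IsSmoothFieldNear X x)
    (hY : IsSmoothFieldNear Y x) :
    cov (VectorField.mlieBracket (𝓡 n) X Y) x =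
      cov (fun y ↦ cov Y y (X y)) x - cov (fun y ↦ cov X y (Y y)) x := by
  have h1 := h.isSmoothFieldNear_cov hX hY
  have h2 := h.isSmoothFieldNear_cov hY hX
  rw [← h.cov_sub h1 h2]
  refine h.isCovariantDerivativeOn.congr_of_eventuallyEq (hX.mlieBracket hY).isDifferentiableFieldAt
    (h1.sub h2).isDifferentiableFieldAt Filter.univ_mem ?_
  filter_upwards [hX.eventually, hY.eventually] with y h3 h4
  exact (h.torsion_free y (mem_univ y) X Y h3.isDifferentiableFieldAt
    h4.isDifferentiableFieldAt).symm

/-- The first Bianchi identity. -/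
lemma curvatureField_bianchi (h : IsLeviCivitaOn g.form cov univ)
    (hX : IsSmoothFieldNear X x) (hY : IsSmoothFieldNear Y x) (hZ : IsSmoothFieldNear Z x) :
    curvatureField cov X Y Z x + curvatureField cov Y Z X x + curvatureField cov Z X Y x = 0 := by
  have hI : IsManifold (𝓡 n) (minSmoothness ℝ 3) M :=
    IsManifold.of_le (n := ∞) (by simpa using ENat.LEInfty.out)
  have h2 : minSmoothness ℝ 2 ≤ ∞ := by simpa using ENat.LEInfty.out
  -- `∇_A ∇_B C - ∇_A ∇_C B - ∇_[B, C] A = [A, [B, C]]`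
  have key : ∀ A C D : (x : M) → TangentSpace (𝓡 n) x, IsSmoothFieldNear A x →
      IsSmoothFieldNear C x → IsSmoothFieldNear D x →
      cov (fun y ↦ cov D y (C y)) x (A x) - cov (fun y ↦ cov C y (D y)) x (A x) -
        cov A x (VectorField.mlieBracket (𝓡 n) C D x) =
      VectorField.mlieBracket (𝓡 n) A (VectorField.mlieBracket (𝓡 n) C D) x := by
    intro A C D hA hC hD
    rw [← h.torsion_free x (mem_univ x) _ _ hA.isDifferentiableFieldAt
      (hC.mlieBracket hD).isDifferentiableFieldAt, h.cov_mlieBracket hC hD]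
    rfl
  have J := VectorField.leibniz_identity_mlieBracket_apply (hX.contMDiffAt.of_le h2)
    (hY.contMDiffAt.of_le h2) (hZ.contMDiffAt.of_le h2)
  have k1 := key X Y Z hX hY hZ
  have k2 := key Y Z X hY hZ hX
  have k3 := key Z X Y hZ hX hY
  have e1 : VectorField.mlieBracket (𝓡 n) Y (VectorField.mlieBracket (𝓡 n) Z X) x =
      -VectorField.mlieBracket (𝓡 n) Y (VectorField.mlieBracket (𝓡 n) X Z) x := by
    rw [VectorField.mlieBracket_swap (V := Z) (W := X), ← neg_one_smul ℝ
      (VectorField.mlieBracket (𝓡 n) X Z), VectorField.mlieBracket_const_smul_right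
      (hX.mlieBracket hZ).isDifferentiableFieldAt, neg_one_smul]
  rw [J] at k1
  rw [e1] at k2
  rw [VectorField.mlieBracket_swap_apply (V := Z)
    (W := VectorField.mlieBracket (𝓡 n) X Y)] at k3
  have e2 : (cov (fun y ↦ cov Z y (Y y)) x (X x) - cov (fun y ↦ cov Y y (Z y)) x (X x) -
        cov X x (VectorField.mlieBracket (𝓡 n) Y Z x)) +
      (cov (fun y ↦ cov X y (Z y)) x (Y x) - cov (fun y ↦ cov Z y (X y)) x (Y x) -
        cov Y x (VectorField.mlieBracket (𝓡 n) Z X x)) +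
      (cov (fun y ↦ cov Y y (X y)) x (Z x) - cov (fun y ↦ cov X y (Y y)) x (Z x) -
        cov Z x (VectorField.mlieBracket (𝓡 n) X Y x)) = 0 := by
    rw [k1, k2, k3]
    abel
  rw [← e2]
  simp only [curvatureField]
  abel

/-- A metric connection has skew curvature operators. -/
lemma curvatureField_skew [NeZero n] (h : IsLeviCivitaOn g.form cov univ)
    (hX : IsSmoothFieldNear X x) (hY : IsSmoothFieldNear Y x) (hZ : IsSmoothFieldNear Z x)
    (hW : IsSmoothFieldNear W x) :
    g.form x (curvatureField cov X Y Z x) (W x) + g.form x (Z x) (curvatureField cov X Y W x) =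
      0 := by
  have hd : ∀ A : (x : M) → TangentSpace (𝓡 n) x,
      (fun y ↦ mvfderiv (𝓡 n) (fun y ↦ g.form y (Z y) (W y)) y (A y)) =ᶠ[𝓝 x]
      (fun y ↦ g.form y (cov Z y (A y)) (W y)) + fun y ↦ g.form y (Z y) (cov W y (A y)) := by
    intro A
    filter_upwards [hZ.eventually, hW.eventually] with y h1 h2
    exact h.metric y (mem_univ y) Z W h1.isDifferentiableFieldAt h2.isDifferentiableFieldAt (A y)
  have hsm : ∀ A C, IsSmoothFieldNear A x → IsSmoothFieldNear C x → MDifferentiableAt (𝓡 n) 𝓘(ℝ, ℝ)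
      (fun y ↦ g.form y (A y) (C y)) x :=
    fun A C hA hC ↦ (g.contMDiffAt_apply hA hC).mdifferentiableAt (by simp)
  have hd2 : ∀ A, IsSmoothFieldNear A x → ∀ v,
      mvfderiv (𝓡 n) (fun y ↦ mvfderiv (𝓡 n) (fun y ↦ g.form y (Z y) (W y)) y (A y)) x v =
      g.form x (cov (fun y ↦ cov Z y (A y)) x v) (W x) + g.form x (cov Z x (A x)) (cov W x v) +
      (g.form x (cov Z x v) (cov W x (A x)) + g.form x (Z x) (cov (fun y ↦ cov W y (A y)) x v)) := by
    intro A hA v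
    have hAZ := h.isSmoothFieldNear_cov hA hZ
    have hAW := h.isSmoothFieldNear_cov hA hW
    have e : mvfderiv (𝓡 n) (fun y ↦ mvfderiv (𝓡 n) (fun y ↦ g.form y (Z y) (W y)) y (A y)) x =
        mvfderiv (𝓡 n) ((fun y ↦ g.form y (cov Z y (A y)) (W y)) +
          fun y ↦ g.form y (Z y) (cov W y (A y))) x := by
      exact mvfderiv_congr (hd A)
    rw [e, mvfderiv_add (hsm _ _ hAZ hW) (hsm _ _ hZ hAW)]
    have e1 := h.metric x (mem_univ x) _ W hAZ.isDifferentiableFieldAt hW.isDifferentiableFieldAt v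
    have e2 := h.metric x (mem_univ x) Z _ hZ.isDifferentiableFieldAt hAW.isDifferentiableFieldAt v
    exact congr_arg₂ (· + ·) e1 e2
  have hm : ∀ A, IsSmoothFieldNear A x → MDifferentiableAt (𝓡 n) 𝓘(ℝ, ℝ)
      (fun y ↦ mvfderiv (𝓡 n) (fun y ↦ g.form y (Z y) (W y)) y (A y)) x := by
    intro A hA
    refine MDifferentiableAt.congr_of_eventuallyEq ?_ (hd A)
    exact (hsm _ _ (h.isSmoothFieldNear_cov hA hZ) hW).add
      (hsm _ _ hZ (h.isSmoothFieldNear_cov hA hW))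
  have hb := mvfderiv_mlieBracket hX hY (f := fun y ↦ g.form y (Z y) (W y))
    (by filter_upwards [hZ.eventually, hW.eventually] with y h1 h2
        exact g.contMDiffAt_apply h1 h2) (hm X hX) (hm Y hY)
  rw [hd2 Y hY, hd2 X hX, h.metric x (mem_univ x) Z W hZ.isDifferentiableFieldAt
    hW.isDifferentiableFieldAt] at hb
  simp only [curvatureField, map_sub, sub_apply]
  linarith

/-- The pair symmetry of the curvature, a formal consequence of the other symmetries. -/
lemma curvatureField_pair [NeZero n] (h : IsLeviCivitaOn g.form cov univ)
    (hX : IsSmoothFieldNear X x) (hY : IsSmoothFieldNear Y x) (hZ : IsSmoothFieldNear Z x)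
    (hW : IsSmoothFieldNear W x) :
    g.form x (Z x) (curvatureField cov X Y W x) = g.form x (X x) (curvatureField cov Z W Y x) := by
  have b : ∀ A C D E : (x : M) → TangentSpace (𝓡 n) x, IsSmoothFieldNear A x →
      IsSmoothFieldNear C x → IsSmoothFieldNear D x →
      g.form x (E x) (curvatureField cov A C D x) + g.form x (E x) (curvatureField cov C D A x) +
        g.form x (E x) (curvatureField cov D A C x) = 0 := by
    intro A C D E hA hC hD
    rw [← map_add, ← map_add, h.curvatureField_bianchi hA hC hD, map_zero]
  have s : ∀ A C D E : (x : M) → TangentSpace (𝓡 n) x, IsSmoothFieldNear A x →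
      IsSmoothFieldNear C x → IsSmoothFieldNear D x → IsSmoothFieldNear E x →
      g.form x (E x) (curvatureField cov A C D x) =
        -g.form x (D x) (curvatureField cov A C E x) := by
    intro A C D E hA hC hD hE
    have := h.curvatureField_skew hA hC hD hE
    rw [g.symm x (E x)]
    linarith
  have t : ∀ A C D E : (x : M) → TangentSpace (𝓡 n) x,
      g.form x (E x) (curvatureField cov A C D x) =
        -g.form x (E x) (curvatureField cov C A D x) := by
    intro A C D E
    rw [curvatureField_swap, map_neg]
  have b1 := b X Y W Z hX hY hW
  have b2 := b Y Z W X hY hZ hW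
  have b3 := b X Z W Y hX hZ hW
  have b4 := b X Y Z W hX hY hZ
  have s1 := s X Y W Z hX hY hW hZ
  have s2 := s Y W X Z hY hW hX hZ
  have s3 := s W X Y Z hW hX hY hZ
  have s4 := s Y Z W X hY hZ hW hX
  have s5 := s Z W Y X hZ hW hY hX
  have s6 := s X Z W Y hX hZ hW hY
  have t1 := t W Y Z X
  have t2 := t W X Z Y
  have t3 := t Z X Y W
  linarith

/-- The curvature of a Levi-Civita connection is tensorial: it depends only on the values of the
fields at the point. By the symmetries every slot can be moved to the slot of the metric. -/
lemma curvatureField_eq_curvature [NeZero n] (h : IsLeviCivitaOn g.form cov univ)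
    (hX : IsSmoothFieldNear X x) (hY : IsSmoothFieldNear Y x) (hZ : IsSmoothFieldNear Z x) :
    curvatureField cov X Y Z x = curvature cov x (X x) (Y x) (Z x) := by
  have nd : ∀ v w : TangentSpace (𝓡 n) x, (∀ z, g.form x z v = g.form x z w) → v = w := by
    intro v w hz
    refine sub_eq_zero.1 (g.nondegenerate x _ fun z ↦ ?_)
    rw [g.symm, map_sub, hz, sub_self]
  have first : ∀ A A' C D : (x : M) → TangentSpace (𝓡 n) x, IsSmoothFieldNear A x →
      IsSmoothFieldNear A' x → IsSmoothFieldNear C x → IsSmoothFieldNear D x → A x = A' x →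
      curvatureField cov A C D x = curvatureField cov A' C D x := by
    intro A A' C D hA hA' hC hD e
    refine nd _ _ fun z ↦ ?_
    have hz := IsSmoothFieldNear.extend z
    have e1 := h.curvatureField_pair hA hC hz hD
    have e2 := h.curvatureField_pair hA' hC hz hD
    rw [FiberBundle.extend_apply_self] at e1 e2
    rw [e1, e2, e]
  have third : ∀ A C D D' : (x : M) → TangentSpace (𝓡 n) x, IsSmoothFieldNear A x →
      IsSmoothFieldNear C x → IsSmoothFieldNear D x → IsSmoothFieldNear D' x → D x = D' x →
      curvatureField cov A C D x = curvatureField cov A C D' x := by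
    intro A C D D' hA hC hD hD' e
    refine nd _ _ fun z ↦ ?_
    have hz := IsSmoothFieldNear.extend z
    have e1 := h.curvatureField_skew hA hC hz hD
    have e2 := h.curvatureField_skew hA hC hz hD'
    rw [FiberBundle.extend_apply_self] at e1 e2
    rw [e] at e1
    linarith
  have hX' := IsSmoothFieldNear.extend (X x)
  have hY' := IsSmoothFieldNear.extend (Y x)
  have hZ' := IsSmoothFieldNear.extend (Z x)
  rw [curvature, third X Y Z _ hX hY hZ hZ' (FiberBundle.extend_apply_self _ _).symm,
    first X _ Y _ hX hX' hY hZ' (FiberBundle.extend_apply_self _ _).symm, curvatureField_swap,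
    first Y _ _ _ hY hY' hX' hZ' (FiberBundle.extend_apply_self _ _).symm, ← curvatureField_swap]

lemma curvature_bianchi (h : IsLeviCivitaOn g.form cov univ) (u v w : TangentSpace (𝓡 n) x) :
    curvature cov x u v w + curvature cov x v w u + curvature cov x w u v = 0 :=
  h.curvatureField_bianchi (.extend u) (.extend v) (.extend w)

lemma curvature_skew [NeZero n] (h : IsLeviCivitaOn g.form cov univ)
    (u v w z : TangentSpace (𝓡 n) x) :
    g.form x z (curvature cov x u v w) = -g.form x w (curvature cov x u v z) := by
  have := h.curvatureField_skew (.extend u) (.extend v) (.extend w) (.extend z)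
  simp only [FiberBundle.extend_apply_self] at this
  rw [g.symm x z]
  exact eq_neg_of_add_eq_zero_left this

lemma curvature_pair [NeZero n] (h : IsLeviCivitaOn g.form cov univ)
    (u v w z : TangentSpace (𝓡 n) x) :
    g.form x z (curvature cov x u v w) = g.form x u (curvature cov x z w v) := by
  have := h.curvatureField_pair (.extend u) (.extend v) (.extend z) (.extend w)
  simp only [FiberBundle.extend_apply_self] at this
  exact this

end IsLeviCivitaOn

/-! ### The curvature tensor as a multilinear form -/

section

variable {n : ℕ} {M : Type u} [TopologicalSpace M]
  [ChartedSpace (EuclideanSpace ℝ (Fin n)) M]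

/-- The vectors `tangentFrame x` as a basis of the tangent space. -/
def tangentBasis (x : M) : Module.Basis (Fin n) ℝ (TangentSpace (𝓡 n) x) :=
  show Module.Basis (Fin n) ℝ (EuclideanSpace ℝ (Fin n)) from
    (EuclideanSpace.basisFun (Fin n) ℝ).toBasis

lemma tangentBasis_apply (x : M) (i : Fin n) : tangentBasis x i = tangentFrame x i := by
  change (EuclideanSpace.basisFun (Fin n) ℝ).toBasis i = EuclideanSpace.single i 1
  simp

variable [IsManifold (𝓡 n) ∞ M]

/-- The metric on a tangent space as a bilinear form. -/
def PseudoRiemannianMetric.bilin (g : PseudoRiemannianMetric n M) (x : M) :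
    LinearMap.BilinForm ℝ (TangentSpace (𝓡 n) x) :=
  LinearMap.mk₂ ℝ (fun v w ↦ g.form x v w) (by simp) (by simp) (by simp) (by simp)

lemma PseudoRiemannianMetric.bilin_apply (g : PseudoRiemannianMetric n M) (x : M)
    (v w : TangentSpace (𝓡 n) x) : g.bilin x v w = g.form x v w :=
  rfl

lemma PseudoRiemannianMetric.inverseMetric_eq (g : PseudoRiemannianMetric n M) (x : M) :
    inverseMetric g.form x = inverseGram (g.bilin x) (tangentBasis x) := by
  simp [inverseMetric, inverseGram, tangentBasis_apply, g.bilin_apply]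

/-- Raising the index of the covector `g(·, v)` gives back the coordinates of `v`. -/
lemma PseudoRiemannianMetric.sum_inverseGram_form (g : PseudoRiemannianMetric n M) (x : M)
    (v : TangentSpace (𝓡 n) x) (a : Fin n) :
    ∑ b, inverseGram (g.bilin x) (tangentBasis x) a b * g.form x (tangentBasis x b) v =
      tangentCoord x v a := by
  have : v = ∑ c, tangentCoord x v c • tangentBasis x c := ((tangentBasis x).sum_repr v).symm
  conv_lhs => rw [this]
  simp only [map_sum, map_smul, smul_eq_mul, Finset.mul_sum]
  rw [Finset.sum_comm]
  have e : ∀ c, ∑ b, inverseGram (g.bilin x) (tangentBasis x) a b *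
      (tangentCoord x v c * g.form x (tangentBasis x b) (tangentBasis x c)) =
      tangentCoord x v c * if a = c then 1 else 0 := by
    intro c
    rw [← sum_inverseGram_mul (g := g.bilin x) (e := tangentBasis x) (g.symm x)
      (g.nondegenerate x) c a, Finset.mul_sum]
    refine Finset.sum_congr rfl fun b _ ↦ ?_
    rw [g.bilin_apply, g.symm x (tangentBasis x b)]
    ring
  simp [e]

variable [T2Space M] [NeZero n] {g : PseudoRiemannianMetric n M}
  {cov : ((x : M) → TangentSpace (𝓡 n) x) →
      ((x : M) → TangentSpace (𝓡 n) x →L[ℝ] TangentSpace (𝓡 n) x)}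

/-- The curvature tensor `R(u, v, z, w) = g(z, R(u, v) w)`. -/
def IsLeviCivitaOn.riemann (h : IsLeviCivitaOn g.form cov univ) (x : M) :
    TangentSpace (𝓡 n) x →ₗ[ℝ] TangentSpace (𝓡 n) x →ₗ[ℝ] TangentSpace (𝓡 n) x →ₗ[ℝ]
      TangentSpace (𝓡 n) x →ₗ[ℝ] ℝ :=
  -- linearity in `z` is clear, and the symmetries move every other argument to that slot
  have add₁ (u u' v w z : TangentSpace (𝓡 n) x) : g.form x z (curvature cov x (u + u') v w) =
      g.form x z (curvature cov x u v w) + g.form x z (curvature cov x u' v w) := by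
    simp only [h.curvature_pair _ v w z, map_add, add_apply]
  have smul₁ (c : ℝ) (u v w z : TangentSpace (𝓡 n) x) : g.form x z (curvature cov x (c • u) v w) =
      c * g.form x z (curvature cov x u v w) := by
    simp only [h.curvature_pair _ v w z, map_smul, smul_apply, smul_eq_mul]
  LinearMap.mk₂ ℝ (fun u v ↦ LinearMap.mk₂ ℝ (fun z w ↦ g.form x z (curvature cov x u v w))
      (by simp) (by simp)
      (fun z w w' ↦ by
        simp only [h.curvature_skew u v _ z, map_add, add_apply]; ring)
      (fun c z w ↦ by
        simp only [h.curvature_skew u v _ z, map_smul, smul_apply, smul_eq_mul]; ring))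
    (fun u u' v ↦ LinearMap.ext₂ fun z w ↦ add₁ u u' v w z)
    (fun c u v ↦ LinearMap.ext₂ fun z w ↦ smul₁ c u v w z)
    (fun u v v' ↦ LinearMap.ext₂ fun z w ↦ by
      simp only [LinearMap.mk₂_apply, curvature_swap cov x u, map_neg, add₁, LinearMap.add_apply]
      ring)
    (fun c u v ↦ LinearMap.ext₂ fun z w ↦ by
      simp only [LinearMap.mk₂_apply, curvature_swap cov x u, map_neg, smul₁, LinearMap.smul_apply,
        smul_eq_mul]
      ring)

lemma IsLeviCivitaOn.riemann_apply (h : IsLeviCivitaOn g.form cov univ) (x : M)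
    (u v z w : TangentSpace (𝓡 n) x) : h.riemann x u v z w = g.form x z (curvature cov x u v w) :=
  rfl

end

/-! ### Weak genericity of Ricci-flat metrics -/

section

variable {n : ℕ} {M : Type u} [TopologicalSpace M]
  [ChartedSpace (EuclideanSpace ℝ (Fin n)) M] [IsManifold (𝓡 n) ∞ M]
  {g : PseudoRiemannianMetric n M}
  {cov : ((x : M) → TangentSpace (𝓡 n) x) →
      ((x : M) → TangentSpace (𝓡 n) x →L[ℝ] TangentSpace (𝓡 n) x)}

namespace IsRicciFlat

lemma projectiveWeyl_eq (hR : IsRicciFlat cov) (x : M) (u v w : TangentSpace (𝓡 n) x) :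
    projectiveWeyl cov x u v w = curvature cov x u v w := by
  simp [projectiveWeyl, projectiveSchouten, projectiveBeta, hR x]

lemma conformalWeyl_eq (hR : IsRicciFlat cov) (x : M) (u v z w : TangentSpace (𝓡 n) x) :
    conformalWeyl g.form cov x u v z w = g.form x z (curvature cov x u v w) := by
  simp [conformalWeyl, conformalSchouten, scalarCurvature, hR x]

lemma conformalWeylVanishesAt_iff (hR : IsRicciFlat cov) (x : M) :
    ConformalWeylVanishesAt g.form cov x ↔ ∀ u v w, curvature cov x u v w = 0 := by
  simp only [ConformalWeylVanishesAt, hR.conformalWeyl_eq]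
  refine ⟨fun h u v w ↦ g.nondegenerate x _ fun z ↦ ?_, fun h u v z w ↦ by simp [h]⟩
  rw [g.symm]
  exact h u v z w

end IsRicciFlat

/-- A Levi-Civita connection restricts to every open set. -/
lemma IsLeviCivitaOn.mono [T2Space M] (h : IsLeviCivitaOn g.form cov univ) {U : Set M}
    (hU : IsOpen U) : IsLeviCivitaOn g.form cov U where
  isCovariantDerivativeOn := h.isCovariantDerivativeOn.mono (subset_univ U)
  smooth := ⟨fun {σ} hσ x hx ↦ by
    have : IsSmoothFieldNear σ x := by
      filter_upwards [hU.mem_nhds hx] with y hy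
      exact (hσ y hy).contMDiffAt (hU.mem_nhds hy)
    exact (h.contMDiffAt_cov this).contMDiffWithinAt⟩
  torsion_free x _ := h.torsion_free x (mem_univ x)
  metric x _ := h.metric x (mem_univ x)

/-- The points at which the curvature is not zero form an open set. -/
lemma IsLeviCivitaOn.eventually_curvature_ne_zero [T2Space M] [NeZero n]
    (h : IsLeviCivitaOn g.form cov univ) {x : M} (hx : ¬ ∀ u v w, curvature cov x u v w = 0) :
    ∀ᶠ y in 𝓝 x, ¬ ∀ u v w, curvature cov y u v w = 0 := by
  push Not at hx
  obtain ⟨u, v, w, hx⟩ := hx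
  obtain ⟨z, hz⟩ : ∃ z, g.form x (curvature cov x u v w) z ≠ 0 := by
    by_contra! hz
    exact hx (g.nondegenerate x _ hz)
  have hu := IsSmoothFieldNear.extend u
  have hv := IsSmoothFieldNear.extend v
  have hw := IsSmoothFieldNear.extend w
  have hR : IsSmoothFieldNear (curvatureField cov (FiberBundle.extend (EuclideanSpace ℝ (Fin n)) u)
      (FiberBundle.extend (EuclideanSpace ℝ (Fin n)) v)
      (FiberBundle.extend (EuclideanSpace ℝ (Fin n)) w)) x :=
    ((h.isSmoothFieldNear_cov hu (h.isSmoothFieldNear_cov hv hw)).sub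
      (h.isSmoothFieldNear_cov hv (h.isSmoothFieldNear_cov hu hw))).sub
      (h.isSmoothFieldNear_cov (hu.mlieBracket hv) hw)
  have hc := (g.contMDiffAt_apply hR (.extend z)).continuousAt
  filter_upwards [hc.eventually_ne (y := 0) (by rwa [FiberBundle.extend_apply_self]),
    hu.eventually, hv.eventually, hw.eventually] with y hy h1 h2 h3 h0
  rw [h.curvatureField_eq_curvature h1 h2 h3, h0] at hy
  simp at hy

end

section DimensionFour

variable {M : Type u} [TopologicalSpace M] [T2Space M]
  [ChartedSpace (EuclideanSpace ℝ (Fin 4)) M] [IsManifold (𝓡 4) ∞ M]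
  {g : PseudoRiemannianMetric 4 M}
  {cov : ((x : M) → TangentSpace (𝓡 4) x) →
      ((x : M) → TangentSpace (𝓡 4) x →L[ℝ] TangentSpace (𝓡 4) x)}

namespace IsLeviCivitaOn

/-- The curvature of a Ricci-flat metric has the algebraic symmetries of a Weyl tensor. -/
lemma isRicciFlatCurvature (h : IsLeviCivitaOn g.form cov univ) (hR : IsRicciFlat cov) (x : M) :
    IsRicciFlatCurvature (g.bilin x) (tangentBasis x) (h.riemann x) where
  symm := g.symm x
  nondegenerate := g.nondegenerate x
  swap u v z w := by simp only [h.riemann_apply, curvature_swap cov x u v, map_neg]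
  skew u v z w := h.curvature_skew u v w z
  pair u v z w := h.curvature_pair u v w z
  bianchi u v z w := by
    simp only [h.riemann_apply]
    rw [← map_add, ← map_add, h.curvature_bianchi, map_zero]
  trace v w := by
    rw [← hR x v w, ricci]
    refine Finset.sum_congr rfl fun a _ ↦ ?_
    rw [← tangentBasis_apply, ← g.sum_inverseGram_form]
    rfl

lemma conformalWeylComp_eq (h : IsLeviCivitaOn g.form cov univ) (hR : IsRicciFlat cov) (x : M)
    (a b c d : Fin 4) : conformalWeylComp g.form cov x a b c d =
      h.riemann x (tangentBasis x a) (tangentBasis x b) (tangentBasis x c) (tangentBasis x d) := by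
  simp only [conformalWeylComp, hR.conformalWeyl_eq, h.riemann_apply, tangentBasis_apply]

lemma conformalWeylNormSq_eq (h : IsLeviCivitaOn g.form cov univ) (hR : IsRicciFlat cov) (x : M) :
    conformalWeylNormSq g.form cov x =
      tensorNormSq (g.bilin x) (tangentBasis x) (h.riemann x) := by
  simp only [conformalWeylNormSq, tensorNormSq, g.inverseMetric_eq, h.conformalWeylComp_eq hR]

/-- `4 W_{ij}ᵏ_l W^{ij}_kᵐ = |W|² δᵐ_l` for the Weyl tensor of a Ricci-flat metric. -/
theorem four_mul_conformalWeyl (h : IsLeviCivitaOn g.form cov univ) (hR : IsRicciFlat cov) (x : M)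
    (l m : Fin 4) :
    4 * ∑ i : Fin 4, ∑ j : Fin 4, ∑ k : Fin 4,
        conformalWeylMixed g.form cov x i j k l * conformalWeylRaised g.form cov x i j k m =
      conformalWeylNormSq g.form cov x * (if m = l then 1 else 0) := by
  rw [h.conformalWeylNormSq_eq hR, ← (h.isRicciFlatCurvature hR x).four_mul_sum_mixed]
  simp only [conformalWeylMixed, conformalWeylRaised, g.inverseMetric_eq, h.conformalWeylComp_eq hR]

/-- A covector `g(z, ·)` in the kernel of the Weyl map gives a vector `z` that is contracted to zero
with the Weyl tensor. -/
theorem isWeaklyGenericAt_of_normSq_ne_zero (h : IsLeviCivitaOn g.form cov univ)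
    (hR : IsRicciFlat cov) {x : M} (hx : conformalWeylNormSq g.form cov x ≠ 0) :
    IsWeaklyGenericAt cov x := by
  intro θ hθ
  have : FiniteDimensional ℝ (TangentSpace (𝓡 4) x) := (tangentBasis x).finiteDimensional_of_finite
  have hn : (g.bilin x).Nondegenerate :=
    ⟨g.nondegenerate x, fun v hv ↦ g.nondegenerate x v fun w ↦ (g.symm x v w).trans (hv w)⟩
  set z := (LinearMap.BilinForm.toDual (g.bilin x) hn).symm θ.toLinearMap with hz
  have hz' : ∀ v, g.form x z v = θ v := fun v ↦
    LinearMap.BilinForm.apply_toDual_symm_apply (hB := hn) θ.toLinearMap v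
  rw [h.conformalWeylNormSq_eq hR] at hx
  have : z = 0 := (h.isRicciFlatCurvature hR x).eq_zero_of_forall_eq_zero hx fun u v w ↦ by
    rw [h.riemann_apply, hz', ← hR.projectiveWeyl_eq, hθ]
  ext v
  rw [← hz', this]
  simp

/-- One direction needs only that some covector is not zero; the other one that `|W|²` vanishes for
a definite metric only together with `W`. -/
theorem isWeaklyGenericAt_iff (h : IsLeviCivitaOn g.form cov univ) (hR : IsRicciFlat cov)
    (hg : g.IsRiemannian) (x : M) :
    IsWeaklyGenericAt cov x ↔ ¬ ConformalWeylVanishesAt g.form cov x := by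
  rw [hR.conformalWeylVanishesAt_iff]
  refine ⟨fun hx h0 ↦ ?_, fun hx ↦ h.isWeaklyGenericAt_of_normSq_ne_zero hR fun hN ↦ hx ?_⟩
  · have := hx (g.form x (tangentFrame x 0)) fun u v w ↦ by
      rw [hR.projectiveWeyl_eq, h0, map_zero]
    have h1 := g.nondegenerate x (tangentFrame x 0) fun w ↦ by rw [this]; rfl
    rw [← tangentBasis_apply] at h1
    exact (tangentBasis x).ne_zero 0 h1
  · rw [h.conformalWeylNormSq_eq hR] at hN
    have := (h.isRicciFlatCurvature hR x).eq_zero_of_tensorNormSq_eq_zero (hg x) hN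
    intro u v w
    refine g.nondegenerate x _ fun z ↦ ?_
    rw [g.symm, ← h.riemann_apply, this]
    rfl

/-- A Ricci-flat metric with zero Weyl tensor is flat, so outside the flat locus there are points
with non-zero Weyl tensor, and these form an open set. -/
theorem exists_isOpen_isWeaklyGenericAt (h : IsLeviCivitaOn g.form cov univ)
    (hR : IsRicciFlat cov) (hg : g.IsRiemannian) {U : Set M} (hU : IsOpen U)
    (hc : ¬ IsConformallyFlatOn g.form U) :
    ∃ V : Set M, IsOpen V ∧ V.Nonempty ∧ V ⊆ U ∧ ∀ x ∈ V, IsWeaklyGenericAt cov x := by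
  simp only [h.isWeaklyGenericAt_iff hR hg, hR.conformalWeylVanishesAt_iff]
  refine ⟨U ∩ {x | ¬ ∀ u v w, curvature cov x u v w = 0},
    hU.inter (isOpen_iff_mem_nhds.2 fun x hx ↦ h.eventually_curvature_ne_zero hx), ?_,
    inter_subset_left, fun x hx ↦ hx.2⟩
  by_contra hV
  rw [not_nonempty_iff_eq_empty] at hV
  refine hc fun x hx ↦ ⟨U, hU, hx, subset_rfl, fun _ ↦ 1, contMDiffOn_const,
    fun _ _ ↦ one_pos, cov, by simpa using h.mono hU, fun y hy ↦ ?_⟩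
  by_contra hy'
  exact (hV ▸ (⟨hy, hy'⟩ : y ∈ U ∩ {x | ¬ ∀ u v w, curvature cov x u v w = 0}) : y ∈ (∅ : Set M))

end IsLeviCivitaOn

end DimensionFour

/-! ### Connections on a vector space -/

section VectorSpace

variable {F : Type*} [NormedAddCommGroup F] [NormedSpace ℝ F]
  {X Y : (x : F) → TangentSpace 𝓘(ℝ, F) x} {x : F}

/-- On a vector space the tangent bundle is trivial, and a vector field is differentiable when it is
differentiable as a map. -/
lemma mdifferentiableAt_field_iff_differentiableAt :
    MDifferentiableAt 𝓘(ℝ, F) (𝓘(ℝ, F).prod 𝓘(ℝ, F))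
      (fun y ↦ (⟨y, X y⟩ : TotalSpace F (TangentSpace 𝓘(ℝ, F) : F → Type _))) x ↔
      DifferentiableAt ℝ (fun y ↦ (show F from X y)) x := by
  refine (mdifferentiableAt_section _ _).trans ?_
  refine Iff.trans ?_ mdifferentiableAt_iff_differentiableAt
  simp only [trivializationAt_model_space_apply]

lemma contMDiff_hom_of_contDiff
    {A : (x : F) → TangentSpace 𝓘(ℝ, F) x →L[ℝ] TangentSpace 𝓘(ℝ, F) x}
    (hA : ContDiff ℝ ∞ (fun x ↦ (show F →L[ℝ] F from A x))) :
    ContMDiff 𝓘(ℝ, F) (𝓘(ℝ, F).prod 𝓘(ℝ, F →L[ℝ] F)) ∞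
      (fun y ↦ (⟨y, A y⟩ : TotalSpace (F →L[ℝ] F)
        fun x : F ↦ TangentSpace 𝓘(ℝ, F) x →L[ℝ] TangentSpace 𝓘(ℝ, F) x)) := by
  intro x
  refine (contMDiffAt_hom_bundle _).2 ⟨contMDiffAt_id, ?_⟩
  refine hA.contMDiff.contMDiffAt.congr_of_eventuallyEq (.of_forall fun y ↦ ?_)
  exact inCoordinates_tangent_bundle_core_model_space x y x y _

lemma contMDiff_bilin_of_contDiff
    {A : (x : F) → TangentSpace 𝓘(ℝ, F) x →L[ℝ] TangentSpace 𝓘(ℝ, F) x →L[ℝ] ℝ}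
    (hA : ContDiff ℝ ∞ (fun x ↦ (show F →L[ℝ] F →L[ℝ] ℝ from A x))) :
    ContMDiff 𝓘(ℝ, F) (𝓘(ℝ, F).prod 𝓘(ℝ, F →L[ℝ] F →L[ℝ] ℝ)) ∞
      (fun y ↦ (⟨y, A y⟩ : TotalSpace (F →L[ℝ] F →L[ℝ] ℝ)
        fun x : F ↦ TangentSpace 𝓘(ℝ, F) x →L[ℝ] TangentSpace 𝓘(ℝ, F) x →L[ℝ] ℝ)) := by
  intro x
  refine (contMDiffAt_hom_bundle _).2 ⟨contMDiffAt_id, ?_⟩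
  refine hA.contMDiff.contMDiffAt.congr_of_eventuallyEq (.of_forall fun y ↦ ?_)
  have h (v : F) : (trivializationAt F (TangentSpace 𝓘(ℝ, F)) x).symm y v = v :=
    (Trivialization.symmL_apply (R := ℝ) _ (mem_univ _) _).symm.trans
      (DFunLike.congr_fun (TangentBundle.symmL_model_space (𝕜 := ℝ) (F := F) x y) v)
  ext v w
  refine (inCoordinates_apply_eq₂ (F₃ := ℝ) (E₃ := Bundle.Trivial F ℝ)
    (mem_univ _) (mem_univ _) (mem_univ _)).trans ?_
  refine (DFunLike.congr_fun (Trivial.linearMapAt_trivialization (𝕜 := ℝ) F ℝ y) _).trans ?_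
  exact congrArg₂ (fun a b ↦ A y a b) (h v) (h w)

lemma contDiff_of_contMDiff_field
    (h : ContMDiff 𝓘(ℝ, F) (𝓘(ℝ, F).prod 𝓘(ℝ, F)) ∞
      (fun y ↦ (⟨y, X y⟩ : TotalSpace F (TangentSpace 𝓘(ℝ, F) : F → Type _)))) :
    ContDiff ℝ ∞ (fun y ↦ (show F from X y)) :=
  contMDiff_vectorSpace_iff_contDiff.1 h

lemma mvfderiv_eq_fderiv (f : F → ℝ) (x v : F) : mvfderiv 𝓘(ℝ, F) f x v = fderiv ℝ f x v :=
  DFunLike.congr_fun (mfderiv_eq_fderiv (f := f) (x := x)) v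

lemma mlieBracket_eq_sub_fderiv (X Y : (x : F) → TangentSpace 𝓘(ℝ, F) x) (x : F) :
    VectorField.mlieBracket 𝓘(ℝ, F) X Y x =
      fderiv ℝ (fun y ↦ (show F from Y y)) x (X x) -
        fderiv ℝ (fun y ↦ (show F from X y)) x (Y x) := by
  refine (congrFun (VectorField.mlieBracketWithin_univ (I := 𝓘(ℝ, F)) (V := X) (W := Y)).symm
    x).trans <| (congrFun (VectorField.mlieBracketWithin_eq_lieBracketWithin (𝕜 := ℝ) (V := X)
      (W := Y) (s := univ)) x).trans ?_
  exact congrFun (VectorField.lieBracketWithin_univ (𝕜 := ℝ) (V := fun y ↦ (show F from X y))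
    (W := fun y ↦ (show F from Y y))) x

lemma fderiv_bilin_apply {B : F → F →L[ℝ] F →L[ℝ] ℝ} {Y Z : F → F} {x : F}
    (hB : DifferentiableAt ℝ B x) (hY : DifferentiableAt ℝ Y x) (hZ : DifferentiableAt ℝ Z x)
    (v : F) : fderiv ℝ (fun y ↦ B y (Y y) (Z y)) x v =
      fderiv ℝ B x v (Y x) (Z x) + B x (fderiv ℝ Y x v) (Z x) + B x (Y x) (fderiv ℝ Z x v) := by
  have h := (hB.hasFDerivAt.clm_apply hY.hasFDerivAt).clm_apply hZ.hasFDerivAt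
  rw [h.fderiv]
  simp
  ring

/-- The affine connection `∇_v X = DX(v) + Γ(X, v)` on a vector space. -/
def christoffelConnection (Γ : F → F →L[ℝ] F →L[ℝ] F) :
    CovariantDerivative 𝓘(ℝ, F) F (TangentSpace 𝓘(ℝ, F) : F → Type _) where
  -- the type ascriptions read a vector field on `F` as a map `F → F`
  toFun X x := fderiv ℝ (fun y ↦ (show F from X y)) x + Γ x (X x)
  isCovariantDerivativeOnUniv :=
    { add := fun {X Y x} hX hY _ ↦ by
        have hX := mdifferentiableAt_field_iff_differentiableAt.1 hX
        have hY := mdifferentiableAt_field_iff_differentiableAt.1 hY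
        refine (congrArg₂ (· + ·) (fderiv_add hX hY) ((Γ x).map_add (X x) (Y x))).trans ?_
        exact add_add_add_comm _ _ _ _
      leibniz := fun {X f x} hX hf _ ↦ by
        have hX := mdifferentiableAt_field_iff_differentiableAt.1 hX
        have hf := mdifferentiableAt_iff_differentiableAt.1 hf
        refine (congrArg₂ (· + ·) (fderiv_fun_smul hf hX) ((Γ x).map_smul (f x) (X x))).trans ?_
        refine (add_right_comm _ _ _).trans (congrArg₂ (· + ·) (smul_add _ _ _).symm ?_)
        exact congrArg (fun a ↦ ContinuousLinearMap.smulRight a (show F from X x))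
          mfderiv_eq_fderiv.symm }

lemma christoffelConnection_apply (Γ : F → F →L[ℝ] F →L[ℝ] F)
    (X : (x : F) → TangentSpace 𝓘(ℝ, F) x) (x v : F) :
    christoffelConnection Γ X x v =
      fderiv ℝ (fun y ↦ (show F from X y)) x v + Γ x (show F from X x) v := rfl

lemma contMDiffCovariantDerivativeOn_christoffelConnection {Γ : F → F →L[ℝ] F →L[ℝ] F}
    (hΓ : ContDiff ℝ ∞ Γ) :
    ContMDiffCovariantDerivativeOn F ∞ (christoffelConnection Γ) univ where
  contMDiff {X} hX := by
    have hX : ContDiff ℝ ∞ (fun y ↦ (show F from X y)) :=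
      contDiff_of_contMDiff_field (contMDiffOn_univ.1 hX)
    exact (contMDiff_hom_of_contDiff ((hX.fderiv_right le_rfl).add (hΓ.clm_apply hX))).contMDiffOn

end VectorSpace

section EuclideanSpace

variable {n : ℕ} {Γ : EuclideanSpace ℝ (Fin n) →
  EuclideanSpace ℝ (Fin n) →L[ℝ] EuclideanSpace ℝ (Fin n) →L[ℝ] EuclideanSpace ℝ (Fin n)}

/-- The connection with symmetric Christoffel symbols `Γ` is the Levi-Civita connection of `B`
as soon as `DB(v)(y, z) = B(Γ(y, v), z) + B(y, Γ(z, v))`. -/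
lemma isLeviCivitaOn_christoffelConnection
    {B : EuclideanSpace ℝ (Fin n) →
      EuclideanSpace ℝ (Fin n) →L[ℝ] EuclideanSpace ℝ (Fin n) →L[ℝ] ℝ}
    (hΓ : ContDiff ℝ ∞ Γ) (hB : Differentiable ℝ B) (hsymm : ∀ x v w, Γ x v w = Γ x w v)
    (hBΓ : ∀ x v y z, fderiv ℝ B x v y z = B x (Γ x y v) z + B x y (Γ x z v)) :
    IsLeviCivitaOn B (christoffelConnection Γ) univ where
  isCovariantDerivativeOn := (christoffelConnection Γ).isCovariantDerivativeOnUniv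
  smooth := contMDiffCovariantDerivativeOn_christoffelConnection hΓ
  torsion_free x _ X Y _ _ := by
    refine Eq.trans ?_ (mlieBracket_eq_sub_fderiv X Y x).symm
    refine (congrArg₂ (· - ·) (christoffelConnection_apply Γ Y x (X x))
      (christoffelConnection_apply Γ X x (Y x))).trans ?_
    have := hsymm x (X x) (Y x)
    refine (congrArg (fun a : EuclideanSpace ℝ (Fin n) ↦ _ - (_ + a)) this).trans ?_
    exact add_sub_add_right_eq_sub _ _ _
  metric x _ Y Z hY hZ v := by
    have hY := mdifferentiableAt_field_iff_differentiableAt.1 hY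
    have hZ := mdifferentiableAt_field_iff_differentiableAt.1 hZ
    refine (mvfderiv_eq_fderiv _ x v).trans ?_
    have key (v a b y z : EuclideanSpace ℝ (Fin n)) :
        fderiv ℝ B x v y z + B x a z + B x y b = B x (a + Γ x y v) z + B x y (b + Γ x z v) := by
      rw [hBΓ, map_add, map_add, add_apply]
      ring
    exact (fderiv_bilin_apply (hB x) hY hZ v).trans (key v _ _ _ _)

lemma isSmoothFieldNear_const (w x : EuclideanSpace ℝ (Fin n)) :
    IsSmoothFieldNear (fun _ ↦ w : (x : EuclideanSpace ℝ (Fin n)) → TangentSpace (𝓡 n) x) x :=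
  .of_forall fun _ ↦ (contMDiff_vectorSpace_iff_contDiff.2 contDiff_const).contMDiffAt

/-- `R(u, v) w = DΓ(u)(w, v) - DΓ(v)(w, u) + Γ(Γ(w, v), u) - Γ(Γ(w, u), v)`. -/
lemma curvature_christoffelConnection [NeZero n]
    {g : PseudoRiemannianMetric n (EuclideanSpace ℝ (Fin n))} (hΓ : ContDiff ℝ ∞ Γ)
    (h : IsLeviCivitaOn g.form (christoffelConnection Γ) univ)
    (x u v w : EuclideanSpace ℝ (Fin n)) :
    curvature (christoffelConnection Γ) x u v w =
      fderiv ℝ Γ x u w v - fderiv ℝ Γ x v w u + Γ x (Γ x w v) u - Γ x (Γ x w u) v := by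
  have hc (w v y : EuclideanSpace ℝ (Fin n)) :
      christoffelConnection Γ (fun _ ↦ w) y v = Γ y w v := by
    refine (christoffelConnection_apply Γ _ y v).trans ?_
    simp
    rfl
  have hcc (w v u : EuclideanSpace ℝ (Fin n)) :
      christoffelConnection Γ (fun y ↦ christoffelConnection Γ (fun _ ↦ w) y v) x u =
        fderiv ℝ Γ x u w v + Γ x (Γ x w v) u := by
    refine (christoffelConnection_apply Γ _ x u).trans ?_
    have h1 : (fun y ↦ (show EuclideanSpace ℝ (Fin n) from
        christoffelConnection Γ (fun _ ↦ w) y v)) = fun y ↦ Γ y w v := funext fun y ↦ hc w v y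
    have hd := (((hΓ.differentiable (by simp)) x).hasFDerivAt.clm_apply
      (hasFDerivAt_const w x)).clm_apply (hasFDerivAt_const v x)
    refine (congrArg₂ (· + ·) (DFunLike.congr_fun (congrArg (fun f ↦ fderiv ℝ f x) h1) u)
      (congrArg (fun a ↦ Γ x a u) (hc w v x))).trans ?_
    refine (congrArg (· + _) (DFunLike.congr_fun hd.fderiv u)).trans ?_
    simp
    rfl
  have hb : VectorField.mlieBracket (𝓡 n)
      (fun _ ↦ u : (x : EuclideanSpace ℝ (Fin n)) → TangentSpace (𝓡 n) x) (fun _ ↦ v) x = 0 := by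
    refine (mlieBracket_eq_sub_fderiv _ _ x).trans ?_
    simp
    rfl
  have := h.curvatureField_eq_curvature (isSmoothFieldNear_const u x)
    (isSmoothFieldNear_const v x) (isSmoothFieldNear_const w x)
  refine this.symm.trans ?_
  refine (congrArg₂ (· - ·) (congrArg₂ (· - ·) (hcc w v u) (hcc w u v))
    ((congrArg _ hb).trans (map_zero _))).trans ?_
  refine (sub_zero _).trans ?_
  abel

end EuclideanSpace

/-! ### The Kasner metric -/

lemma contDiff_sum_smul_const {ι E F : Type*} [Fintype ι] [NormedAddCommGroup E]
    [NormedSpace ℝ E] [NormedAddCommGroup F] [NormedSpace ℝ F] {f : ι → E → ℝ}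
    (hf : ∀ i, ContDiff ℝ ∞ (f i)) (v : ι → F) : ContDiff ℝ ∞ (fun x ↦ ∑ i, f i x • v i) := by
  fun_prop

lemma fderiv_bilin_apply_const {E F : Type*} [NormedAddCommGroup E] [NormedSpace ℝ E]
    [NormedAddCommGroup F] [NormedSpace ℝ F] {B : E → E →L[ℝ] E →L[ℝ] F} {x : E}
    (hB : DifferentiableAt ℝ B x) (u v w : E) :
    fderiv ℝ B x u v w = fderiv ℝ (fun y ↦ B y v w) x u := by
  have h := (hB.hasFDerivAt.clm_apply (hasFDerivAt_const v x)).clm_apply (hasFDerivAt_const w x)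
  rw [h.fderiv]
  simp

/-- The bilinear map `(v, w) ↦ α(v) β(w) e`. -/
def rankOneBilin {E F : Type*} [NormedAddCommGroup E] [NormedSpace ℝ E] [NormedAddCommGroup F]
    [NormedSpace ℝ F] (α β : E →L[ℝ] ℝ) (e : F) : E →L[ℝ] E →L[ℝ] F :=
  α.smulRight (β.smulRight e)

lemma sum_smul_rankOneBilin_apply {ι E F : Type*} [Fintype ι] [NormedAddCommGroup E]
    [NormedSpace ℝ E] [NormedAddCommGroup F] [NormedSpace ℝ F] (c : ι → ℝ) (α β : ι → E →L[ℝ] ℝ)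
    (e : ι → F) (v w : E) :
    (∑ i, c i • rankOneBilin (α i) (β i) (e i)) v w = ∑ i, (c i * (α i v * β i w)) • e i := by
  simp [rankOneBilin, sum_apply, smul_smul, mul_assoc]

/-- The exponents `a = (3, 2, 2, -1)` of the metric `∑ᵢ exp(2 aᵢ x₀) dxᵢ²`. Such a metric is Ricci-flat
because `a₀ = a₁ + a₂ + a₃` and `a₀² = a₁² + a₂² + a₃²`; it is the Kasner metric with exponents
`(2/3, 2/3, -1/3)` in the coordinate `x₀ = log (3 t) / 3`, in Riemannian signature. -/
def kasnerExponent : Fin 4 → ℝ := ![3, 2, 2, -1]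

/-- The bilinear form `∑ᵢ exp(2 aᵢ x₀) dxᵢ²`. -/
def kasnerForm (x : EuclideanSpace ℝ (Fin 4)) :
    EuclideanSpace ℝ (Fin 4) →L[ℝ] EuclideanSpace ℝ (Fin 4) →L[ℝ] ℝ :=
  ∑ i, Real.exp (2 * kasnerExponent i * x 0) •
    rankOneBilin (EuclideanSpace.proj (𝕜 := ℝ) i) (EuclideanSpace.proj (𝕜 := ℝ) i) (1 : ℝ)

/-- The part of the Christoffel symbols of `kasnerForm` that does not depend on the point,
`(v, w) ↦ ∑ᵢ aᵢ (v₀ wᵢ + vᵢ w₀) eᵢ`. -/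
def kasnerSymbolConst :
    EuclideanSpace ℝ (Fin 4) →L[ℝ] EuclideanSpace ℝ (Fin 4) →L[ℝ] EuclideanSpace ℝ (Fin 4) :=
  ∑ i, kasnerExponent i • rankOneBilin (EuclideanSpace.proj (𝕜 := ℝ) 0)
      (EuclideanSpace.proj (𝕜 := ℝ) i) (EuclideanSpace.single i (1 : ℝ)) +
    ∑ i, kasnerExponent i • rankOneBilin (EuclideanSpace.proj (𝕜 := ℝ) i)
      (EuclideanSpace.proj (𝕜 := ℝ) 0) (EuclideanSpace.single i (1 : ℝ))

/-- The Christoffel symbols of `kasnerForm`: the part independent of the point and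
`(v, w) ↦ - ∑ᵢ aᵢ exp(2 (aᵢ - 3) x₀) vᵢ wᵢ e₀`. -/
def kasnerSymbol (x : EuclideanSpace ℝ (Fin 4)) :
    EuclideanSpace ℝ (Fin 4) →L[ℝ] EuclideanSpace ℝ (Fin 4) →L[ℝ] EuclideanSpace ℝ (Fin 4) :=
  kasnerSymbolConst + ∑ i, (-(kasnerExponent i * Real.exp (2 * (kasnerExponent i - 3) * x 0))) •
    rankOneBilin (EuclideanSpace.proj (𝕜 := ℝ) i) (EuclideanSpace.proj (𝕜 := ℝ) i)
      (EuclideanSpace.single 0 (1 : ℝ))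

lemma kasnerForm_apply (x v w : EuclideanSpace ℝ (Fin 4)) :
    kasnerForm x v w = ∑ i, Real.exp (2 * kasnerExponent i * x 0) * (v i * w i) := by
  refine (sum_smul_rankOneBilin_apply _ _ _ _ v w).trans ?_
  simp

lemma kasnerForm_self_pos (x : EuclideanSpace ℝ (Fin 4)) {v : EuclideanSpace ℝ (Fin 4)}
    (hv : v ≠ 0) : 0 < kasnerForm x v v := by
  have hn : ∀ i ∈ Finset.univ, 0 ≤ Real.exp (2 * kasnerExponent i * x 0) * (v i * v i) :=
    fun i _ ↦ mul_nonneg (Real.exp_pos _).le (mul_self_nonneg _)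
  rw [kasnerForm_apply]
  refine (Finset.sum_nonneg hn).lt_of_ne' fun h ↦ hv (PiLp.ext fun i ↦ ?_)
  have h0 := (Finset.sum_eq_zero_iff_of_nonneg hn).1 h i (Finset.mem_univ i)
  exact mul_self_eq_zero.1 ((mul_eq_zero.1 h0).resolve_left (Real.exp_pos _).ne')

lemma kasnerSymbol_apply (x v w : EuclideanSpace ℝ (Fin 4)) (i : Fin 4) :
    kasnerSymbol x v w i = kasnerExponent i * (v 0 * w i + v i * w 0) -
      if i = 0 then ∑ j, kasnerExponent j * Real.exp (2 * (kasnerExponent j - 3) * x 0) *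
        (v j * w j) else 0 := by
  rw [kasnerSymbol, kasnerSymbolConst, add_apply, add_apply, add_apply, add_apply,
    sum_smul_rankOneBilin_apply, sum_smul_rankOneBilin_apply, sum_smul_rankOneBilin_apply]
  fin_cases i <;> simp [Fin.sum_univ_four] <;> ring

lemma contDiff_kasnerForm : ContDiff ℝ ∞ kasnerForm :=
  contDiff_sum_smul_const (fun i ↦ by fun_prop) _

lemma contDiff_kasnerSymbol : ContDiff ℝ ∞ kasnerSymbol :=
  contDiff_const.add (contDiff_sum_smul_const (fun i ↦ by fun_prop) _)

lemma fderiv_exp_mul (c : ℝ) (x v : EuclideanSpace ℝ (Fin 4)) :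
    fderiv ℝ (fun x : EuclideanSpace ℝ (Fin 4) ↦ Real.exp (c * x 0)) x v =
      c * Real.exp (c * x 0) * v 0 := by
  have := (((EuclideanSpace.proj (𝕜 := ℝ) (0 : Fin 4)).hasFDerivAt (x := x)).const_mul c).exp
  refine (DFunLike.congr_fun this.fderiv v).trans ?_
  simp
  ring

lemma fderiv_sum_exp_mul (b c d : Fin 4 → ℝ) (x v : EuclideanSpace ℝ (Fin 4)) :
    fderiv ℝ (fun x : EuclideanSpace ℝ (Fin 4) ↦ ∑ i, b i * Real.exp (c i * x 0) * d i) x v =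
      v 0 * ∑ i, b i * c i * Real.exp (c i * x 0) * d i := by
  rw [fderiv_fun_sum fun i _ ↦ by fun_prop, sum_apply, Finset.mul_sum]
  refine Finset.sum_congr rfl fun i _ ↦ ?_
  rw [fderiv_mul_const (by fun_prop), fderiv_const_mul (by fun_prop), smul_apply, smul_apply,
    fderiv_exp_mul, smul_eq_mul, smul_eq_mul]
  ring

lemma fderiv_kasnerForm_apply (x v y z : EuclideanSpace ℝ (Fin 4)) :
    fderiv ℝ kasnerForm x v y z = v 0 * ∑ i, 1 * (2 * kasnerExponent i) *
      Real.exp (2 * kasnerExponent i * x 0) * (y i * z i) := by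
  refine (fderiv_bilin_apply_const (contDiff_kasnerForm.differentiable (by simp) x) v y z).trans ?_
  rw [← fderiv_sum_exp_mul]
  simp only [kasnerForm_apply, one_mul]

lemma fderiv_kasnerSymbol_apply (x u v w : EuclideanSpace ℝ (Fin 4)) :
    fderiv ℝ kasnerSymbol x u v w = (u 0 * ∑ i, -kasnerExponent i * (2 * (kasnerExponent i - 3)) *
      Real.exp (2 * (kasnerExponent i - 3) * x 0) * (v i * w i)) •
        EuclideanSpace.single 0 (1 : ℝ) := by
  refine (fderiv_bilin_apply_const
    (contDiff_kasnerSymbol.differentiable (by simp) x) u v w).trans ?_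
  have h : (fun y ↦ kasnerSymbol y v w) = fun y ↦ kasnerSymbolConst v w + (∑ i, -kasnerExponent i *
      Real.exp (2 * (kasnerExponent i - 3) * y 0) * (v i * w i)) •
        EuclideanSpace.single 0 (1 : ℝ) := by
    ext y : 1
    rw [kasnerSymbol, add_apply, add_apply, sum_smul_rankOneBilin_apply, Finset.sum_smul]
    simp only [neg_mul]
    rfl
  rw [h, fderiv_const_add, fderiv_smul_const (by fun_prop), ← fderiv_sum_exp_mul]
  rfl

/-- The metric `∑ᵢ exp(2 aᵢ x₀) dxᵢ²` on `ℝ⁴`. -/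
def kasnerMetric : PseudoRiemannianMetric 4 (EuclideanSpace ℝ (Fin 4)) where
  form := kasnerForm
  symm x v w := by
    refine (kasnerForm_apply x v w).trans (Eq.trans ?_ (kasnerForm_apply x w v).symm)
    exact Finset.sum_congr rfl fun i _ ↦ congrArg _ (mul_comm _ _)
  nondegenerate x v hv := by
    by_contra h
    exact (kasnerForm_self_pos x h).ne' (hv v)
  contMDiff := contMDiff_bilin_of_contDiff contDiff_kasnerForm

lemma kasnerMetric_isRiemannian : kasnerMetric.IsRiemannian :=
  fun x _ hv ↦ kasnerForm_self_pos x hv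

lemma kasnerMetric_isLeviCivitaOn :
    IsLeviCivitaOn kasnerMetric.form (christoffelConnection kasnerSymbol) univ := by
  refine isLeviCivitaOn_christoffelConnection contDiff_kasnerSymbol
    (contDiff_kasnerForm.differentiable (by simp)) (fun x v w ↦ ?_) fun x v y z ↦ ?_
  · ext i
    rw [kasnerSymbol_apply, kasnerSymbol_apply]
    simp only [Fin.sum_univ_four]
    ring_nf
  · -- since `a₀ = 3`, lowering the upper index `0` of the symbols gives the factor `exp(6 x₀)`
    have hexp (i : Fin 4) : Real.exp (2 * kasnerExponent i * x 0) =
        Real.exp (6 * x 0) * Real.exp (2 * (kasnerExponent i - 3) * x 0) := by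
      rw [← Real.exp_add]
      ring_nf
    refine (fderiv_kasnerForm_apply x v y z).trans (Eq.trans ?_ (congrArg₂ (· + ·)
      (kasnerForm_apply x _ _) (kasnerForm_apply x _ _)).symm)
    simp only [kasnerSymbol_apply, hexp, Fin.sum_univ_four]
    simp [kasnerExponent]
    ring

/-- The curvature of the Kasner metric at `(e₀, e₁, e₀)` is `-2 e₁`. -/
lemma kasnerMetric_curvature_zero_one_zero (x : EuclideanSpace ℝ (Fin 4)) :
    curvature (christoffelConnection kasnerSymbol) x
      (EuclideanSpace.single (0 : Fin 4) (1 : ℝ) : EuclideanSpace ℝ (Fin 4))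
      (EuclideanSpace.single (1 : Fin 4) (1 : ℝ) : EuclideanSpace ℝ (Fin 4))
      (EuclideanSpace.single (0 : Fin 4) (1 : ℝ) : EuclideanSpace ℝ (Fin 4)) =
      (EuclideanSpace.single (1 : Fin 4) (-2 : ℝ) : EuclideanSpace ℝ (Fin 4)) := by
  refine (curvature_christoffelConnection contDiff_kasnerSymbol kasnerMetric_isLeviCivitaOn
    x _ _ _).trans (PiLp.ext fun i ↦ ?_)
  simp only [PiLp.add_apply, PiLp.sub_apply, PiLp.smul_apply, fderiv_kasnerSymbol_apply,
    kasnerSymbol_apply, Fin.sum_univ_four]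
  fin_cases i <;> simp [kasnerExponent]
  ring

lemma kasnerMetric_isRicciFlat : IsRicciFlat (christoffelConnection kasnerSymbol) := by
  intro x v w
  have h (c : Fin 4) : tangentCoord x (curvature (christoffelConnection kasnerSymbol) x
      (tangentFrame x c) v w) c = _ :=
    congrArg (fun a : EuclideanSpace ℝ (Fin 4) ↦ a c) (curvature_christoffelConnection
      contDiff_kasnerSymbol kasnerMetric_isLeviCivitaOn x (EuclideanSpace.single c 1) v w)
  refine (Finset.sum_congr rfl fun c _ ↦ h c).trans ?_
  have key (v w : EuclideanSpace ℝ (Fin 4)) : ∑ c, (fderiv ℝ kasnerSymbol x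
      (EuclideanSpace.single c 1) w v - fderiv ℝ kasnerSymbol x v w (EuclideanSpace.single c 1) +
      kasnerSymbol x (kasnerSymbol x w v) (EuclideanSpace.single c 1) -
      kasnerSymbol x (kasnerSymbol x w (EuclideanSpace.single c 1)) v) c = 0 := by
    simp only [PiLp.add_apply, PiLp.sub_apply, PiLp.smul_apply, fderiv_kasnerSymbol_apply,
      kasnerSymbol_apply, Fin.sum_univ_four]
    simp [kasnerExponent]
    ring
  exact key v w

end

theorem mainTheorem12 :
    (∀ (M : Type u) [TopologicalSpace M] [T2Space M] [SecondCountableTopology M]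
        [ChartedSpace (EuclideanSpace ℝ (Fin 4)) M] [IsManifold (𝓡 4) ∞ M]
        (g : PseudoRiemannianMetric 4 M)
        (cov : CovariantDerivative (𝓡 4) (EuclideanSpace ℝ (Fin 4))
          (TangentSpace (𝓡 4) : M → Type)),
      IsLeviCivitaOn g.form cov univ → IsRicciFlat cov →
        -- the projective and the conformal Weyl tensors agree
        (∀ (x : M) (u v z w : TangentSpace (𝓡 4) x),
          g.form x z (projectiveWeyl cov x u v w) = conformalWeyl g.form cov x u v z w) ∧
        -- `4 W_{ij}ᵏ_l W^{ij}_kᵐ = |W|² δᵐ_l`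
        (∀ (x : M) (l m : Fin 4),
          4 * ∑ i : Fin 4, ∑ j : Fin 4, ∑ k : Fin 4,
              conformalWeylMixed g.form cov x i j k l * conformalWeylRaised g.form cov x i j k m =
            conformalWeylNormSq g.form cov x * (if m = l then 1 else 0)) ∧
        -- any signature: weakly generic wherever `|W|²` is not zero
        (∀ x : M, conformalWeylNormSq g.form cov x ≠ 0 → IsWeaklyGenericAt cov x) ∧
        (g.IsRiemannian →
          -- weakly generic exactly at the points where the conformal Weyl tensor is not zero
          (∀ x : M, IsWeaklyGenericAt cov x ↔ ¬ ConformalWeylVanishesAt g.form cov x) ∧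
          ((∀ x : M, ¬ ConformalWeylVanishesAt g.form cov x) → IsWeaklyGeneric cov) ∧
          -- near some point of each open set on which the metric is not conformally flat
          (∀ U : Set M, IsOpen U → ¬ IsConformallyFlatOn g.form U →
            ∃ V : Set M, IsOpen V ∧ V.Nonempty ∧ V ⊆ U ∧ ∀ x ∈ V, IsWeaklyGenericAt cov x))) ∧
    -- such connections exist, already on `ℝ⁴`
    (∃ (g : PseudoRiemannianMetric 4 (EuclideanSpace ℝ (Fin 4)))
        (cov : CovariantDerivative (𝓡 4) (EuclideanSpace ℝ (Fin 4))
          (TangentSpace (𝓡 4) : EuclideanSpace ℝ (Fin 4) → Type)),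
      g.IsRiemannian ∧ IsLeviCivitaOn g.form cov univ ∧ IsRicciFlat cov ∧
        (∀ x, ¬ ConformalWeylVanishesAt g.form cov x) ∧
        cov.torsion = 0 ∧ IsWeaklyGeneric cov) := by

  constructor
  · intro M _ _ _ _ _ g cov h hR
    refine ⟨fun x u v z w ↦ ?_, h.four_mul_conformalWeyl hR,
      fun _ hx ↦ h.isWeaklyGenericAt_of_normSq_ne_zero hR hx, fun hg ↦ ?_⟩
    · rw [hR.projectiveWeyl_eq, hR.conformalWeyl_eq]
    · have hiff := h.isWeaklyGenericAt_iff hR hg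
      exact ⟨hiff, fun hW x ↦ (hiff x).2 (hW x),
        fun U hU hc ↦ h.exists_isOpen_isWeaklyGenericAt hR hg hU hc⟩
  · have h := kasnerMetric_isLeviCivitaOn
    have hW (x : EuclideanSpace ℝ (Fin 4)) : ¬ ConformalWeylVanishesAt kasnerMetric.form
        (christoffelConnection kasnerSymbol) x := by
      rw [kasnerMetric_isRicciFlat.conformalWeylVanishesAt_iff]
      intro h0
      have := congrArg (fun a : EuclideanSpace ℝ (Fin 4) ↦ a 1)
        ((kasnerMetric_curvature_zero_one_zero x).symm.trans (h0 _ _ _))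
      have h2 : (EuclideanSpace.single (1 : Fin 4) (-2 : ℝ)) 1 = (0 : ℝ) := this
      simp at h2
    refine ⟨kasnerMetric, christoffelConnection kasnerSymbol, kasnerMetric_isRiemannian, h,
      kasnerMetric_isRicciFlat, hW, ?_, fun x ↦
        (h.isWeaklyGenericAt_iff kasnerMetric_isRicciFlat kasnerMetric_isRiemannian x).2 (hW x)⟩
    exact (CovariantDerivative.torsion_eq_zero_iff _).2 fun {X Y x} hX hY ↦
      h.torsion_free x (mem_univ x) X Y hX hY
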